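/- For even $k\ge 4$, real $a,b$ and $\operatorname{Im} z>0$ let $$E_k^{a,b}(z)=\sum_{(0,0)\neq(m,n)\in\mathbf Z^2}\frac{e^{2\pi i(an-bm)}}{(mz+n)^k}.$$ Put $\rho=e^{2\pi i/3}$, $\mathscr A=\{e^{i\theta}:\pi/2\le\theta\le 2\pi/3\}$ and $$\mathcal F=\{z:\operatorname{Im} z>0,\ |z|>1,\ -\tfrac12\le\operatorname{Re} z<\tfrac12\}\cup\mathscr A .$$ For $N\ge 1$ let $Z_k$ be the multiset of zeros in $\mathcal F$ of all the Eisenstein series $E_k^{a,b}$ of weight $k$ for $\Gamma(N)$, with $(a,b)$ running over $(N^{-1}\mathbf Z/\mathbf Z)^2$; the multiplicity of $z$ in $Z_k$ is the sum over all $(a,b)$ of the order of vanishing of $E_k^{a,b}$ at $z$. Write $\#$ for the number of elements counted with multiplicity and with weight $1/2$ at $z=i$, weight $1/3$ at $z=\rho$, and weight $1$ at every other point. Define the angular discrepancy $$D_k=\sup_{\frac{\pi}{2}\le\theta_1\le\theta_2\le\frac{2\pi}{3}}\left|\frac{\#\{z\in Z_k:\arg z\in[\theta_1,\theta_2]\}}{\#\{z\in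 Z_k:\operatorname{Re} z<0\}}-\frac{6}{\pi}(\theta_2-\theta_1)\right| .$$ There is an absolute constant $C>0$ such that for every odd $N\ge1$ and every even $k$ that is sufficiently large in terms of $N$, the set of zeros underlying $Z_k$ is finite, $\#\{z\in Z_k:\operatorname{Re} z<0\}>0$ (so that $D_k$ is well defined), and $$D_k\le C\,\frac{\max(1,\log N)}{k}.$$ In particular, for every fixed odd $N$ we have $D_k\to0$ as $k\to\infty$ through even integers: the arguments of the zeros with $\operatorname{Re} z<0$ equidistribute in $\arg\mathscr A=[\pi/2,2\pi/3]$. (For odd $N\ge 3$ the bound reads $D_k\le C\log N/k$.) -/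

import Mathlib

open Filter Topology

noncomputable section

namespace EisensteinZeros

/-- The Eisenstein series `E_k^{a,b}(z) = ∑_{(m,n) ≠ (0,0)} e(an - bm) / (mz + n)^k`,
with `e(x) = exp(2πix)`, the pair `p` being `(m, n)`.
(The series converges absolutely for `k ≥ 3` and `z` in the upper half plane.) -/
def eisenstein (k : ℕ) (a b : ℝ) (z : ℂ) : ℂ :=
  ∑' p : {p : ℤ × ℤ // p ≠ 0},
    Complex.exp (2 * Real.pi * Complex.I * (a * (p.1.2 : ℂ) - b * (p.1.1 : ℂ))) /
      ((p.1.1 : ℂ) * z + (p.1.2 : ℂ)) ^ k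

/-- The member of the family of level `N` whose index is the class of `(A/N, B/N)`
in `(N⁻¹ℤ/ℤ)²`. -/
def levelEisenstein (N k : ℕ) (A B : Fin N) : ℂ → ℂ :=
  eisenstein k ((A : ℝ) / N) ((B : ℝ) / N)

/-- The point `ρ = exp(2πi/3)`. -/
def rho : ℂ := Complex.exp (2 * Real.pi * Complex.I / 3)

/-- The left lower arc `{exp(iθ) : π/2 ≤ θ ≤ 2π/3}`. -/
def arc : Set ℂ :=
  {z | ∃ θ : ℝ, Real.pi / 2 ≤ θ ∧ θ ≤ 2 * Real.pi / 3 ∧ z = Complex.exp (θ * Complex.I)}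

/-- The standard fundamental domain for the full modular group. -/
def fundDomain : Set ℂ :=
  {z | 0 < z.im ∧ 1 < ‖z‖ ∧ -(1 / 2) ≤ z.re ∧ z.re < 1 / 2} ∪ arc

/-- The zeros in the fundamental domain of all Eisenstein series of weight `k` in the family
of level `N`. -/
def zeros (N k : ℕ) : Set ℂ :=
  {z | z ∈ fundDomain ∧ ∃ A B : Fin N, levelEisenstein N k A B z = 0}

/-- The multiplicity of `z` in the union of all zeros: the sum over the index set of the orders of
vanishing at `z`, which is the order of vanishing of the product of all the series. -/
def multiplicity (N k : ℕ) (z : ℂ) : ℕ :=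
  ∑ A : Fin N, ∑ B : Fin N, analyticOrderNatAt (levelEisenstein N k A B) z

open Classical in
/-- The weights at the elliptic points: `1/2` at `i`, `1/3` at `ρ`, and `1` elsewhere. -/
def weight (z : ℂ) : ℝ :=
  if z = Complex.I then 1 / 2 else if z = rho then 1 / 3 else 1

/-- The number of zeros lying in `S`, counted with multiplicity and weight. -/
def zeroCount (N k : ℕ) (S : Set ℂ) : ℝ :=
  ∑ᶠ z ∈ zeros N k ∩ S, weight z * (multiplicity N k z : ℝ)

/-- The angular discrepancy `D_k` in level `N`: the supremum, over all
`π/2 ≤ θ₁ ≤ θ₂ ≤ 2π/3`, of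
`|#(arg(Z_k) ∩ [θ₁, θ₂]) / #(Z_k ∩ {Re z < 0}) - (6/π)(θ₂ - θ₁)|`. -/
def angularDiscrepancy (N k : ℕ) : ℝ :=
  sSup {d : ℝ | ∃ θ₁ θ₂ : ℝ, Real.pi / 2 ≤ θ₁ ∧ θ₁ ≤ θ₂ ∧ θ₂ ≤ 2 * Real.pi / 3 ∧
    d = |zeroCount N k {z | z.arg ∈ Set.Icc θ₁ θ₂} / zeroCount N k {z | z.re < 0}
          - 6 / Real.pi * (θ₂ - θ₁)|}

end EisensteinZeros

end

/-! For large `k` the shortest lattice vectors dominate on the left half of the domain: half of the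
series is `cos 2πa + cos 2πb / z^k + cos 2π(a-b) / (z+1)^k` up to `O((5/6)^k)`. Put `L = max 1 (log
N)`. As `N` is odd, all numbers `|cos 2πA/N|` are at least `1/N ≥ e^{-L}`. Once `|z|^k ≥ e^{3L}` the
constant term wins (`LargeWeight.lower_bound`), so the zeros in the left half lie within `O(L/k)` of
the arc.

If `arg z` stays a multiple of `L/k` below `2π/3`, the third term is negligible too. With `z = e^u`
the equation becomes `ku + Ψ(u) = log(-cos 2πb / cos 2πa) + 2πij` with a tiny `Ψ`
(`LargeWeight.exists_phase`). It has one solution for each admissible `j`, and the zero is simple,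
so the arguments are spaced by about `2π/k`. The real part decides the side: the zeros are outside
the unit circle if `|cos 2πa| < |cos 2πb|`, and inside it, hence not in the domain, if the
inequality is reversed. Equality forces `b ≡ ±a` for odd `N`; then `z ↦ 1/z̄` preserves the zeros,
and uniqueness puts them on the arc. Near `ρ`, Jensen's formula bounds the number of zeros by
`O(L)`.

So a series has `k(θ₂-θ₁)/2π + O(L)` zeros in a window, or only `O(L)`. Exchanging `a` and `b` shows
that at least half of the `N²` series are of the first kind. On dividing, `N²` cancels and `O(L/k)`
remains. -/

open Filter Topology

noncomputable section

namespace EisensteinZeros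

/-! ### Lattice estimates and the main terms -/

/-- A neighbourhood of the closed left half of the fundamental domain. -/
def leftRegion : Set ℂ :=
  {z | 0 < z.im ∧ -(11 / 20) < z.re ∧ z.re < 1 / 10 ∧ 9 / 10 < Complex.normSq z}

lemma isOpen_leftRegion : IsOpen leftRegion := by
  have h1 := isOpen_lt (continuous_const (y := (0 : ℝ))) Complex.continuous_im
  have h2 := isOpen_lt (continuous_const (y := (-(11 / 20) : ℝ))) Complex.continuous_re
  have h3 := isOpen_lt Complex.continuous_re (continuous_const (y := (1 / 10 : ℝ)))
  have h4 := isOpen_lt (continuous_const (y := (9 / 10 : ℝ))) Complex.continuous_normSq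
  exact h1.inter (h2.inter (h3.inter h4))

/-- The general term of the Eisenstein series. -/
def latticeTerm (k : ℕ) (a b : ℝ) (z : ℂ) (p : ℤ × ℤ) : ℂ :=
  Complex.exp (2 * Real.pi * Complex.I * (a * (p.2 : ℂ) - b * (p.1 : ℂ))) /
      ((p.1 : ℂ) * z + (p.2 : ℂ)) ^ k

lemma norm_character (a b : ℝ) (p : ℤ × ℤ) :
    ‖Complex.exp (2 * Real.pi * Complex.I * (a * (p.2 : ℂ) - b * (p.1 : ℂ)))‖ = 1 := by
  rw [show (2 * Real.pi * Complex.I * (a * (p.2 : ℂ) - b * (p.1 : ℂ)) : ℂ) =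
    ((2 * Real.pi * (a * p.2 - b * p.1) : ℝ) : ℂ) * Complex.I by push_cast; ring]
  exact Complex.norm_exp_ofReal_mul_I _

/-- The origin contributes `1 / 0 ^ k = 0` by the convention for division, so it may be included,
which makes reindexing easy. -/
lemma eisenstein_eq_tsum {k : ℕ} (hk : k ≠ 0) (a b : ℝ) (z : ℂ) :
    eisenstein k a b z = ∑' p : ℤ × ℤ, latticeTerm k a b z p := by
  refine tsum_subtype_eq_of_support_subset (f := latticeTerm k a b z) (s := {p | p ≠ 0}) ?_
  intro p hp h0
  apply hp
  simp only [h0, latticeTerm]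
  simp [hk]

lemma normSq_lattice (z : ℂ) (m n : ℤ) :
    Complex.normSq (m * z + n) =
      (m : ℝ) ^ 2 * Complex.normSq z + 2 * (m * n) * z.re + (n : ℝ) ^ 2 := by
  simp [Complex.normSq_apply]
  ring

lemma normSq_lattice_ge {z : ℂ} (hz : z ∈ leftRegion) (m n : ℤ) :
    2 / 5 * ‖(m, n)‖ ^ 2 ≤ Complex.normSq (m * z + n) := by
  obtain ⟨-, h1, h2, h3⟩ := hz
  rw [normSq_lattice]
  have hx : -(11 / 10) * |(m : ℝ) * n| ≤ 2 * (m * n) * z.re := by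
    have : |2 * ((m : ℝ) * n) * z.re| ≤ 11 / 10 * |(m : ℝ) * n| := by
      rw [abs_mul, abs_mul, abs_two]
      have : |z.re| ≤ 11 / 20 := abs_le.2 ⟨by linarith, by linarith⟩
      nlinarith [abs_nonneg ((m : ℝ) * n)]
    linarith [neg_abs_le (2 * ((m : ℝ) * n) * z.re)]
  rw [abs_mul] at hx
  have hm : (m : ℝ) ^ 2 = |(m : ℝ)| ^ 2 := (sq_abs _).symm
  have hn : (n : ℝ) ^ 2 = |(n : ℝ)| ^ 2 := (sq_abs _).symm
  have hM : 9 / 10 * |(m : ℝ)| ^ 2 ≤ (m : ℝ) ^ 2 * Complex.normSq z := by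
    rw [hm]; nlinarith [sq_nonneg |(m : ℝ)|]
  rw [hn]
  have hnorm : ‖(m, n)‖ = max |(m : ℝ)| |(n : ℝ)| := by
    simp [Prod.norm_def, Int.norm_eq_abs]
  rw [hnorm]
  rcases max_choice |(m : ℝ)| |(n : ℝ)| with h | h <;> rw [h]
  · nlinarith [sq_nonneg (|(m : ℝ)| - 11 / 10 * |(n : ℝ)|),
      sq_nonneg (|(n : ℝ)| - 11 / 20 * |(m : ℝ)|), sq_nonneg |(m : ℝ)|]
  · nlinarith [sq_nonneg (|(m : ℝ)| - 11 / 18 * |(n : ℝ)|), sq_nonneg |(n : ℝ)|]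

lemma norm_lattice_ge {z : ℂ} (hz : z ∈ leftRegion) (p : ℤ × ℤ) :
    3 / 5 * ‖p‖ ≤ ‖(p.1 : ℂ) * z + p.2‖ := by
  have h := normSq_lattice_ge hz p.1 p.2
  rw [Complex.normSq_eq_norm_sq] at h
  refine le_of_sq_le_sq ?_ (norm_nonneg _)
  have : (p.1, p.2) = p := rfl
  rw [this] at h
  nlinarith [sq_nonneg ‖p‖]

lemma one_le_norm_of_ne_zero {p : ℤ × ℤ} (hp : p ≠ 0) : 1 ≤ ‖p‖ := by
  obtain ⟨m, n⟩ := p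
  simp only [Prod.norm_def, Int.norm_eq_abs]
  by_cases hm : m = 0
  · have hn : n ≠ 0 := by
      rintro rfl; exact hp (by simp [hm])
    refine le_max_of_le_right ?_
    exact_mod_cast Int.one_le_abs hn
  · refine le_max_of_le_left ?_
    exact_mod_cast Int.one_le_abs hm

lemma lattice_ne_zero {z : ℂ} (hz : z ∈ leftRegion) {p : ℤ × ℤ} (hp : p ≠ 0) :
    (p.1 : ℂ) * z + p.2 ≠ 0 := by
  rw [← norm_pos_iff]
  linarith [norm_lattice_ge hz p, one_le_norm_of_ne_zero hp]

/-- The lattice points giving the main terms on `leftRegion`. -/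
def mainPoints : Finset (ℤ × ℤ) := {(0, 1), (0, -1), (1, 0), (-1, 0), (1, 1), (-1, -1)}

/-- For sup norm at least 2 the quadratic bound gives `8/5 ≥ 36/25`. In sup norm 1 only `±(1,-1)` is
left, where `Re z < 1/10` suffices. -/
lemma six_fifths_le_norm_lattice {z : ℂ} (hz : z ∈ leftRegion) {p : ℤ × ℤ} (hp : p ≠ 0)
    (hp' : p ∉ mainPoints) : 6 / 5 ≤ ‖(p.1 : ℂ) * z + p.2‖ := by
  refine le_of_sq_le_sq ?_ (norm_nonneg _)
  rw [← Complex.normSq_eq_norm_sq]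
  obtain ⟨m, n⟩ := p
  by_cases h2 : 2 ≤ ‖(m, n)‖
  · have := normSq_lattice_ge hz m n
    nlinarith
  · rw [Prod.norm_def, not_le, max_lt_iff] at h2
    simp only [Int.norm_eq_abs] at h2
    have hm : |m| < 2 := by exact_mod_cast h2.1
    have hn : |n| < 2 := by exact_mod_cast h2.2
    rw [abs_lt] at hm hn
    obtain ⟨-, h1, h2, h3⟩ := hz
    simp only [mainPoints, Finset.mem_insert, Finset.mem_singleton, Prod.mk.injEq, not_or] at hp'
    simp only [ne_eq, Prod.mk_eq_zero] at hp
    rw [normSq_lattice]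
    have : (m = 1 ∧ n = -1) ∨ (m = -1 ∧ n = 1) := by omega
    rcases this with ⟨rfl, rfl⟩ | ⟨rfl, rfl⟩ <;> push_cast <;> nlinarith

lemma summable_inv_norm_pow_three : Summable fun p : ℤ × ℤ ↦ (‖p‖ ^ 3)⁻¹ := by
  have h := EisensteinSeries.summable_one_div_norm_rpow (k := 3) (by norm_num)
  rw [← (finTwoArrowEquiv ℤ).symm.summable_iff] at h
  refine h.congr fun p ↦ ?_
  have : ‖(finTwoArrowEquiv ℤ).symm p‖ = ‖p‖ := by
    rw [EisensteinSeries.norm_eq_max_natAbs, Prod.norm_def]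
    simp [Int.norm_eq_abs]
  simp only [Function.comp_apply]
  rw [this, Real.rpow_neg (norm_nonneg _)]
  norm_cast

/-- Three of the `k` factors give a summable majorant independent of `z`; the other `k - 3` carry
the exponential decay in `k`. -/
lemma norm_latticeTerm_le {k : ℕ} (hk : 3 ≤ k) (a b : ℝ) {z : ℂ} (hz : z ∈ leftRegion)
    {p : ℤ × ℤ} {q : ℝ} (hq : 0 < q) (hqp : p ≠ 0 → q ≤ ‖(p.1 : ℂ) * z + p.2‖) :
    ‖latticeTerm k a b z p‖ ≤ (q ^ (k - 3))⁻¹ * ((3 / 5 : ℝ) ^ 3)⁻¹ * (‖p‖ ^ 3)⁻¹ := by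
  by_cases hp : p = 0
  · have : k ≠ 0 := by omega
    simp [latticeTerm, hp, this]
  rw [latticeTerm, norm_div, norm_character, norm_pow, one_div]
  have h1 := one_le_norm_of_ne_zero hp
  rw [← mul_inv, ← mul_inv]
  gcongr
  calc q ^ (k - 3) * (3 / 5) ^ 3 * ‖p‖ ^ 3 = q ^ (k - 3) * (3 / 5 * ‖p‖) ^ 3 := by ring
    _ ≤ ‖(p.1 : ℂ) * z + p.2‖ ^ (k - 3) * ‖(p.1 : ℂ) * z + p.2‖ ^ 3 := by
      gcongr
      · exact hqp hp
      · exact norm_lattice_ge hz p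
    _ = _ := by rw [← pow_add]; congr 1; omega

lemma norm_latticeTerm_le' {k : ℕ} (hk : 3 ≤ k) (a b : ℝ) {z : ℂ} (hz : z ∈ leftRegion)
    (p : ℤ × ℤ) :
    ‖latticeTerm k a b z p‖ ≤ (((3 / 5 : ℝ)) ^ (k - 3))⁻¹ * ((3 / 5 : ℝ) ^ 3)⁻¹ * (‖p‖ ^ 3)⁻¹ :=
  norm_latticeTerm_le hk a b hz (by norm_num) fun hp ↦ by
    linarith [norm_lattice_ge hz p, one_le_norm_of_ne_zero hp]

lemma summable_latticeTerm {k : ℕ} (hk : 3 ≤ k) (a b : ℝ) {z : ℂ} (hz : z ∈ leftRegion) :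
    Summable (latticeTerm k a b z) :=
  Summable.of_norm_bounded (summable_inv_norm_pow_three.mul_left _)
    (norm_latticeTerm_le' hk a b hz)

lemma differentiableOn_eisenstein {k : ℕ} (hk : 3 ≤ k) (a b : ℝ) :
    DifferentiableOn ℂ (eisenstein k a b) leftRegion := by
  have h0 : k ≠ 0 := by omega
  have : eisenstein k a b = fun z ↦ ∑' p : ℤ × ℤ, latticeTerm k a b z p :=
    funext (eisenstein_eq_tsum h0 a b)
  rw [this]
  refine Complex.differentiableOn_tsum_of_summable_norm (F := fun p z ↦ latticeTerm k a b z p)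
    (summable_inv_norm_pow_three.mul_left _)
    (fun p ↦ ?_) isOpen_leftRegion (fun p z hz ↦ norm_latticeTerm_le' hk a b hz p)
  by_cases hp : p = 0
  · simp [latticeTerm, hp, h0]
  · intro z hz
    have := lattice_ne_zero hz hp
    unfold latticeTerm
    refine DifferentiableAt.differentiableWithinAt (𝕜 := ℂ) ?_
    exact DifferentiableAt.fun_div (by fun_prop) (by fun_prop) (pow_ne_zero _ this)

/-- The coefficient `cos 2πx`. -/
def cosTurn (x : ℝ) : ℝ := Real.cos (2 * Real.pi * x)

lemma abs_cosTurn_le (x : ℝ) : |cosTurn x| ≤ 1 := Real.abs_cos_le_one _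

/-- The main terms of half the Eisenstein series on `leftRegion`. -/
def mainPart (k : ℕ) (a b : ℝ) (z : ℂ) : ℂ :=
  cosTurn a + cosTurn b / z ^ k + cosTurn (a - b) / (z + 1) ^ k

lemma exp_add_exp_neg (x : ℝ) :
    Complex.exp (2 * Real.pi * Complex.I * x) + Complex.exp (2 * Real.pi * Complex.I * (-x)) =
      2 * cosTurn x := by
  rw [cosTurn, Complex.ofReal_cos, Complex.two_cos]
  push_cast
  congr 2 <;> ring

lemma sum_mainPoints {k : ℕ} (hk : Even k) (a b : ℝ) (z : ℂ) :
    ∑ p ∈ mainPoints, latticeTerm k a b z p = 2 * mainPart k a b z := by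
  have h (w : ℂ) : (-w) ^ k = w ^ k := hk.neg_pow w
  have h1 := exp_add_exp_neg a
  have h2 := exp_add_exp_neg b
  have h3 := exp_add_exp_neg (a - b)
  have e1 : (-1 : ℂ) * z + -1 = -(z + 1) := by ring
  have e2 : (-1 : ℂ) ^ k = 1 := hk.neg_one_pow
  have e3 : ((-1 : ℂ) * z) ^ k = z ^ k := by rw [neg_one_mul, h]
  rw [mainPoints, Finset.sum_insert (by decide), Finset.sum_insert (by decide),
    Finset.sum_insert (by decide), Finset.sum_insert (by decide), Finset.sum_insert (by decide),
    Finset.sum_singleton]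
  simp only [latticeTerm, mainPart]
  push_cast at h1 h2 h3 ⊢
  simp only [e1, h, e3, zero_mul, zero_add, add_zero, one_mul, one_pow, mul_add, mul_zero,
    mul_one, zero_sub, sub_zero, div_one]
  rw [mul_div_assoc', mul_div_assoc', ← h1, ← h2, ← h3]
  have e4 : (a : ℂ) * -1 - b * -1 = -(a - b) := by ring
  have e5 : -((b : ℂ) * -1) = b := by ring
  have e6 : (a : ℂ) * -1 = -a := by ring
  rw [e4, e5, e6]
  ring

lemma exists_eisenstein_remainder_bound :
    ∃ K₀ : ℝ, ∀ k : ℕ, 3 ≤ k → Even k → ∀ (a b : ℝ), ∀ z ∈ leftRegion,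
      ‖eisenstein k a b z - 2 * mainPart k a b z‖ ≤ K₀ * (5 / 6) ^ k := by
  refine ⟨(6 / 5) ^ 3 * ((3 / 5 : ℝ) ^ 3)⁻¹ * ∑' p : ℤ × ℤ, (‖p‖ ^ 3)⁻¹, ?_⟩
  intro k hk hk2 a b z hz
  have h0 : k ≠ 0 := by omega
  have hs := summable_latticeTerm hk a b hz
  rw [eisenstein_eq_tsum h0, ← hs.sum_add_tsum_compl (s := mainPoints), sum_mainPoints hk2,
    add_sub_cancel_left]
  have hb (p : ((mainPoints : Set (ℤ × ℤ))ᶜ : Set (ℤ × ℤ))) : ‖latticeTerm k a b z p‖ ≤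
      ((6 / 5 : ℝ) ^ (k - 3))⁻¹ * ((3 / 5 : ℝ) ^ 3)⁻¹ * (‖(p : ℤ × ℤ)‖ ^ 3)⁻¹ :=
    norm_latticeTerm_le hk a b hz (by norm_num)
      fun hp ↦ six_fifths_le_norm_lattice hz hp (fun h ↦ p.2 (Finset.mem_coe.2 h))
  have hsum := summable_inv_norm_pow_three.subtype ((mainPoints : Set (ℤ × ℤ))ᶜ)
  refine (tsum_of_norm_bounded ((hsum.mul_left _).hasSum) hb).trans ?_
  rw [tsum_mul_left]
  have hle : ∑' p : ((mainPoints : Set (ℤ × ℤ))ᶜ : Set (ℤ × ℤ)), (‖(p : ℤ × ℤ)‖ ^ 3)⁻¹ ≤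
      ∑' p : ℤ × ℤ, (‖p‖ ^ 3)⁻¹ :=
    summable_inv_norm_pow_three.tsum_subtype_le _ _ (fun p ↦ by positivity)
  have he : ((6 / 5 : ℝ) ^ (k - 3))⁻¹ = (6 / 5) ^ 3 * (5 / 6) ^ k := by
    rw [← inv_pow, show (6 / 5 : ℝ)⁻¹ = 5 / 6 by norm_num]
    obtain ⟨j, rfl⟩ := Nat.exists_eq_add_of_le hk
    rw [Nat.add_sub_cancel_left, pow_add, ← mul_assoc, ← mul_pow]
    norm_num
  calc _ ≤ ((6 / 5 : ℝ) ^ (k - 3))⁻¹ * ((3 / 5 : ℝ) ^ 3)⁻¹ * ∑' p : ℤ × ℤ, (‖p‖ ^ 3)⁻¹ := by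
        gcongr
        exact hle
    _ = _ := by rw [he]; ring

/-! ### Symmetries of the series -/

lemma conj_character (x : ℂ) (hx : (starRingEnd ℂ) x = x) :
    (starRingEnd ℂ) (Complex.exp (2 * Real.pi * Complex.I * x)) =
      Complex.exp (2 * Real.pi * Complex.I * (-x)) := by
  rw [← Complex.exp_conj]
  simp [hx, Complex.conj_ofNat]

/-- This reflection transfers finiteness of the zero set from the left half of the domain to the
right half. -/
lemma conj_eisenstein_neg_conj {k : ℕ} (hk : Even k) (h0 : k ≠ 0) (a b : ℝ) (z : ℂ) :
    (starRingEnd ℂ) (eisenstein k a b (-(starRingEnd ℂ) z)) = eisenstein k a (-b) z := by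
  rw [eisenstein_eq_tsum h0, eisenstein_eq_tsum h0, Complex.conj_tsum,
    ← ((Equiv.refl ℤ).prodCongr (Equiv.neg ℤ)).tsum_eq]
  refine tsum_congr fun p ↦ ?_
  simp only [latticeTerm, map_div₀, map_pow]
  rw [conj_character _ (by simp)]
  simp only [Equiv.prodCongr_apply, Prod.map, Equiv.refl_apply, Equiv.neg_apply, map_add, map_mul,
    map_neg, Complex.conj_conj, map_intCast]
  rw [← hk.neg_pow]
  push_cast
  congr 2 <;> ring

/-- Reflection in the unit circle exchanges `m` and `n`, hence `a` and `b`. -/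
lemma conj_eisenstein_inv_conj {k : ℕ} (h0 : k ≠ 0) (a b : ℝ) {z : ℂ} (hz : z ≠ 0) :
    (starRingEnd ℂ) (eisenstein k a b ((starRingEnd ℂ) z)⁻¹) = z ^ k * eisenstein k b a z := by
  rw [eisenstein_eq_tsum h0, eisenstein_eq_tsum h0, Complex.conj_tsum,
    ← (Equiv.prodComm ℤ ℤ).tsum_eq, ← tsum_mul_left]
  refine tsum_congr fun p ↦ ?_
  simp only [latticeTerm, map_div₀, map_pow]
  rw [conj_character _ (by simp)]
  simp only [Equiv.prodComm_apply, Prod.fst_swap, Prod.snd_swap, map_add, map_mul, map_inv₀,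
    Complex.conj_conj, map_intCast]
  rw [show (p.2 : ℂ) * z⁻¹ + p.1 = (p.1 * z + p.2) / z by field_simp; ring, div_pow, div_div_eq_mul_div,
    mul_comm (z ^ k), div_mul_eq_mul_div]
  congr 3
  ring_nf

/-- Here `b ≡ -a`, so the exchange negates both parameters, and `p ↦ -p` undoes this for even `k`.
-/
lemma eisenstein_swap_of_add_eq_int {k : ℕ} (hk : Even k) (h0 : k ≠ 0) {a b : ℝ} {m : ℤ}
    (hab : a + b = m) (z : ℂ) : eisenstein k b a z = eisenstein k a b z := by
  rw [eisenstein_eq_tsum h0, eisenstein_eq_tsum h0, ← (Equiv.neg (ℤ × ℤ)).tsum_eq]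
  refine tsum_congr fun p ↦ ?_
  have hb : (b : ℂ) = m - a := by
    rw [show b = m - a by linarith]; push_cast; ring
  simp only [latticeTerm, Equiv.neg_apply, Prod.fst_neg, Prod.snd_neg]
  rw [← hk.neg_pow ((p.1 : ℂ) * z + p.2)]
  push_cast
  congr 1
  · rw [Complex.exp_eq_exp_iff_exists_int]
    refine ⟨m * (p.1 - p.2), ?_⟩
    rw [hb]
    push_cast
    ring
  · congr 1
    ring

/-! ### Large weights and the zero-free region -/

/-- The weight `k` is large in terms of `L`, the coefficients of the main terms are at least
`exp (-L)`, and the remainder is negligible. -/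
structure LargeWeight (k : ℕ) (a b L : ℝ) : Prop where
  even : Even k
  one_le : 1 ≤ L
  le_weight : 10000 * L ≤ k
  left_ge : Real.exp (-L) ≤ |cosTurn a|
  right_ge : Real.exp (-L) ≤ |cosTurn b|
  remainder_le : ∀ z ∈ leftRegion,
    ‖eisenstein k a b z - 2 * mainPart k a b z‖ ≤ Real.exp (-(6 * L))

section

variable {k : ℕ} {a b L : ℝ}

lemma LargeWeight.weight_pos (h : LargeWeight k a b L) : (0 : ℝ) < k := by
  linarith [h.one_le, h.le_weight]

lemma LargeWeight.three_le (h : LargeWeight k a b L) : 3 ≤ k := by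
  have : (3 : ℝ) ≤ k := by linarith [h.one_le, h.le_weight]
  exact_mod_cast this

lemma LargeWeight.div_le (h : LargeWeight k a b L) : L / k ≤ 1 / 10000 := by
  rw [div_le_div_iff₀ h.weight_pos (by norm_num)]
  linarith [h.le_weight]

lemma LargeWeight.inv_le (h : LargeWeight k a b L) : 1 / k ≤ L / k :=
  div_le_div_of_nonneg_right h.one_le h.weight_pos.le

lemma exp_neg_one_lt : Real.exp (-1) < 0.368 := by
  have := Real.exp_neg_one_lt_d9
  linarith

lemma exp_neg_mul_le {L : ℝ} (hL : 1 ≤ L) : Real.exp (-L) ≤ 0.368 :=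
  (Real.exp_le_exp.2 (by linarith)).trans exp_neg_one_lt.le

lemma exp_neg_nat_mul (n : ℕ) (L : ℝ) : Real.exp (-(n * L)) = Real.exp (-L) ^ n := by
  rw [← Real.exp_nat_mul]; congr 1; ring

/-- The left half of the closed fundamental domain. -/
def leftHalf : Set ℂ := {z | 0 < z.im ∧ 1 ≤ ‖z‖ ∧ -(1 / 2) ≤ z.re ∧ z.re ≤ 0}

lemma leftHalf_subset : leftHalf ⊆ leftRegion := by
  rintro z ⟨h1, h2, h3, h4⟩
  refine ⟨h1, by linarith, by linarith, ?_⟩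
  rw [Complex.normSq_eq_norm_sq]
  nlinarith

lemma norm_le_norm_add_one {z : ℂ} (hz : -(1 / 2) ≤ z.re) : ‖z‖ ≤ ‖z + 1‖ := by
  refine le_of_sq_le_sq ?_ (norm_nonneg _)
  rw [← Complex.normSq_eq_norm_sq, ← Complex.normSq_eq_norm_sq, Complex.normSq_apply,
    Complex.normSq_apply]
  simp
  nlinarith

/-- Since `‖z‖ ≤ ‖z + 1‖` here, both non-constant terms are at most `e^{-3L}`, against a constant
term of size at least `e^{-L}`. -/
lemma LargeWeight.lower_bound (h : LargeWeight k a b L) {z : ℂ} (hz : z ∈ leftHalf)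
    (hzk : Real.exp (3 * L) ≤ ‖z‖ ^ k) : Real.exp (-L) ≤ ‖eisenstein k a b z‖ := by
  have hr := h.remainder_le z (leftHalf_subset hz)
  have h3 : Real.exp (-(3 * L)) = Real.exp (-L) ^ 3 := by exact_mod_cast exp_neg_nat_mul 3 L
  have h6 : Real.exp (-(6 * L)) = Real.exp (-L) ^ 6 := by exact_mod_cast exp_neg_nat_mul 6 L
  have hx := exp_neg_mul_le h.one_le
  have hx0 := Real.exp_pos (-L)
  have hpow {w : ℂ} (hw : ‖z‖ ≤ ‖w‖) (c : ℝ) (hc : |c| ≤ 1) :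
      ‖(c : ℂ) / w ^ k‖ ≤ Real.exp (-(3 * L)) := by
    rw [norm_div, norm_pow, Complex.norm_real, Real.norm_eq_abs, Real.exp_neg, ← one_div]
    have : ‖z‖ ^ k ≤ ‖w‖ ^ k := by gcongr
    gcongr
    exact hzk.trans this
  have e1 := hpow le_rfl (cosTurn b) (abs_cosTurn_le b)
  have e2 := hpow (norm_le_norm_add_one hz.2.2.1) (cosTurn (a - b)) (abs_cosTurn_le _)
  have e3 : Real.exp (-L) ≤ ‖(cosTurn a : ℂ)‖ := by
    rw [Complex.norm_real, Real.norm_eq_abs]; exact h.left_ge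
  have e4 : 2 * (cosTurn a : ℂ) = eisenstein k a b z - (eisenstein k a b z - 2 * mainPart k a b z)
      - 2 * (cosTurn b / z ^ k) - 2 * (cosTurn (a - b) / (z + 1) ^ k) := by
    rw [mainPart]; ring
  have e5 : 2 * ‖(cosTurn a : ℂ)‖ ≤ ‖eisenstein k a b z‖ +
      ‖eisenstein k a b z - 2 * mainPart k a b z‖ + 2 * ‖(cosTurn b / z ^ k : ℂ)‖ +
      2 * ‖(cosTurn (a - b) / (z + 1) ^ k : ℂ)‖ := by
    have := congrArg norm e4
    rw [norm_mul, Complex.norm_ofNat] at this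
    rw [this]
    refine (norm_sub_le _ _).trans (add_le_add ((norm_sub_le _ _).trans (add_le_add
      (norm_sub_le _ _) ?_)) ?_) <;> simp
  rw [h3] at e1 e2
  rw [h6] at hr
  have b1 : Real.exp (-L) ^ 3 ≤ 0.136 * Real.exp (-L) := by
    have : Real.exp (-L) ^ 2 ≤ 0.136 := by nlinarith
    rw [pow_succ]
    gcongr
  have b2 : Real.exp (-L) ^ 6 ≤ 0.1 * Real.exp (-L) := by
    have : Real.exp (-L) ^ 6 = Real.exp (-L) ^ 3 * Real.exp (-L) ^ 3 := by ring
    have : Real.exp (-L) ^ 3 ≤ 0.1 := by linarith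
    nlinarith [pow_pos hx0 3]
  linarith

/-- The slope at `t = 0` is `√3/2`; the smaller slope `1/2` is valid on all of `[0,1]` and makes `‖z
+ 1‖` grow linearly away from `ρ`. -/
lemma cos_two_pi_div_three_sub {t : ℝ} (h0 : 0 ≤ t) (h1 : t ≤ 1) :
    -(1 / 2) + t / 2 ≤ Real.cos (2 * Real.pi / 3 - t) := by
  have hc : Real.cos (2 * Real.pi / 3) = -(1 / 2) := by
    rw [show 2 * Real.pi / 3 = Real.pi - Real.pi / 3 by ring, Real.cos_pi_sub, Real.cos_pi_div_three]
  have hs : Real.sin (2 * Real.pi / 3) = √3 / 2 := by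
    rw [show 2 * Real.pi / 3 = Real.pi - Real.pi / 3 by ring, Real.sin_pi_sub, Real.sin_pi_div_three]
  rw [Real.cos_sub, hc, hs]
  have h3 : (1.7 : ℝ) ≤ √3 := Real.le_sqrt_of_sq_le (by norm_num)
  have hsin : 3 / 4 * t ≤ Real.sin t := by
    rcases h0.eq_or_lt with rfl | h0
    · simp
    · have := Real.sin_gt_sub_cube h0
      have : t ^ 3 ≤ t := by nlinarith [mul_nonneg h0.le (sub_nonneg.2 h1)]
      linarith
  nlinarith [Real.cos_le_one t]

/-! ### Logarithmic coordinates and the phase -/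

/-- In logarithmic coordinates, a neighbourhood of the arc away from `ρ`. -/
def logBox (k : ℕ) (L : ℝ) : Set ℂ :=
  {u | |u.re| < 4 * (L / k) ∧ Real.pi / 2 - 3 * (1 / k) < u.im ∧
    u.im < 2 * Real.pi / 3 - 64 * (L / k)}

/-- A slightly smaller box than `logBox`. -/
def innerLogBox (k : ℕ) (L : ℝ) : Set ℂ :=
  {u | |u.re| < 3 * (L / k) ∧ Real.pi / 2 - 2 * (1 / k) < u.im ∧
    u.im < 2 * Real.pi / 3 - 65 * (L / k)}

lemma isOpen_logBox : IsOpen (logBox k L) := by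
  have h1 := isOpen_lt (Complex.continuous_re.abs) (continuous_const (y := 4 * (L / k)))
  have h2 := isOpen_lt (continuous_const (y := Real.pi / 2 - 3 * (1 / (k : ℝ)))) Complex.continuous_im
  have h3 := isOpen_lt Complex.continuous_im
    (continuous_const (y := 2 * Real.pi / 3 - 64 * (L / (k : ℝ))))
  exact h1.inter (h2.inter h3)

lemma convex_innerLogBox : Convex ℝ (innerLogBox k L) := by
  have : innerLogBox k L = ({u | u.re < 3 * (L / k)} ∩ {u | -(3 * (L / k)) < u.re}) ∩
      ({u | Real.pi / 2 - 2 * (1 / (k : ℝ)) < u.im} ∩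
        {u | u.im < 2 * Real.pi / 3 - 65 * (L / (k : ℝ))}) := by
    ext u
    simp only [innerLogBox, Set.mem_ofPred_eq, Set.mem_inter_iff, abs_lt]
    tauto
  rw [this]
  exact ((convex_halfSpace_re_lt _).inter (convex_halfSpace_re_gt _)).inter
    ((convex_halfSpace_im_gt _).inter (convex_halfSpace_im_lt _))

/-- The margin `1/k` is the radius used in Cauchy's estimate for `Ψ'`. -/
lemma LargeWeight.closedBall_subset_logBox (h : LargeWeight k a b L) {u : ℂ}
    (hu : u ∈ innerLogBox k L) : Metric.closedBall u (1 / k) ⊆ logBox k L := by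
  intro v hv
  rw [Metric.mem_closedBall, dist_eq_norm] at hv
  have h1 := (abs_le.1 ((Complex.abs_re_le_norm (v - u)).trans hv))
  have h2 := (abs_le.1 ((Complex.abs_im_le_norm (v - u)).trans hv))
  obtain ⟨g1, g2, g3⟩ := hu
  rw [abs_lt] at g1
  simp only [Complex.sub_re, Complex.sub_im] at h1 h2
  have := h.inv_le
  exact ⟨abs_lt.2 ⟨by linarith, by linarith⟩, by linarith, by linarith⟩

lemma LargeWeight.innerLogBox_subset (h : LargeWeight k a b L) :
    innerLogBox k L ⊆ logBox k L := fun _ hu ↦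
  h.closedBall_subset_logBox hu (Metric.mem_closedBall_self (by have := h.weight_pos; positivity))

lemma exp_bounds {s : ℝ} (h : |s| ≤ 1 / 100) : 1 - |s| ≤ Real.exp s ∧ Real.exp s ≤ 1 + 2 * |s| := by
  constructor
  · linarith [Real.add_one_le_exp s, neg_abs_le s]
  · have := Real.abs_exp_sub_one_le (x := s) (by linarith)
    linarith [le_abs_self (Real.exp s - 1)]

lemma LargeWeight.exp_mem_leftRegion (h : LargeWeight k a b L) {u : ℂ} (hu : u ∈ logBox k L) :
    Complex.exp u ∈ leftRegion := by
  obtain ⟨h1, h2, h3⟩ := hu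
  have hd := h.div_le
  have hi := h.inv_le
  have hi0 : 0 < 1 / (k : ℝ) := by have := h.weight_pos; positivity
  have hpi := Real.pi_gt_three
  have hpi' := Real.pi_lt_four
  have hs : |u.re| ≤ 1 / 100 := by linarith
  have he := exp_bounds hs
  have he0 := Real.exp_pos u.re
  have hc1 : Real.cos u.im ≤ 3 * (1 / k) := by
    have : Real.cos u.im = Real.sin (Real.pi / 2 - u.im) := (Real.sin_pi_div_two_sub _).symm
    rw [this]
    by_cases h0 : 0 ≤ Real.pi / 2 - u.im
    · exact (Real.sin_le h0).trans (by linarith)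
    · refine (Real.sin_nonpos_of_nonpos_of_neg_pi_le (by linarith) (by linarith)).trans (by linarith)
  have hc2 : -(1 / 2) ≤ Real.cos u.im := by
    have := cos_two_pi_div_three_sub (t := 2 * Real.pi / 3 - u.im) (by linarith) (by
      have := Real.pi_lt_d2; linarith)
    rw [sub_sub_cancel] at this
    linarith
  refine ⟨?_, ?_, ?_, ?_⟩
  · rw [Complex.exp_im]
    exact mul_pos he0 (Real.sin_pos_of_pos_of_lt_pi (by linarith) (by linarith))
  · rw [Complex.exp_re]; nlinarith
  · rw [Complex.exp_re]; nlinarith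
  · rw [Complex.normSq_eq_norm_sq, Complex.norm_exp]; nlinarith

/-- At angular distance `t` from `ρ` one has `‖z + 1‖² ≥ 1 + 3t/8 ≥ e^{3t/16}`. For `t ≥ 64L/k` the
`k`th power is at least `e^{12L}`; hence the 64 in `logBox`. -/
lemma LargeWeight.norm_exp_add_one_pow_ge (h : LargeWeight k a b L) {u : ℂ}
    (hu : u ∈ logBox k L) : Real.exp (6 * L) ≤ ‖Complex.exp u + 1‖ ^ k := by
  obtain ⟨h1, h2, h3⟩ := hu
  have hd := h.div_le
  have hi := h.inv_le
  have hk := h.weight_pos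
  have hi0 : 0 < 1 / (k : ℝ) := by positivity
  have hpi := Real.pi_lt_d2
  have he := exp_bounds (s := u.re) (by linarith)
  have he0 := Real.exp_pos u.re
  set t := 2 * Real.pi / 3 - u.im with ht
  have ht1 : t ≤ 1 := by linarith
  have ht0 : 64 * (L / k) ≤ t := by linarith
  have hc := cos_two_pi_div_three_sub (t := t) (by linarith) ht1
  rw [ht, sub_sub_cancel, ← ht] at hc
  have hsq : 1 + 3 / 8 * t ≤ ‖Complex.exp u + 1‖ ^ 2 := by
    rw [← Complex.normSq_eq_norm_sq, Complex.normSq_apply]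
    simp only [Complex.add_re, Complex.add_im, Complex.one_re, Complex.one_im, Complex.exp_re,
      Complex.exp_im]
    have hsc := Real.sin_sq_add_cos_sq u.im
    have : (Real.exp u.re * Real.cos u.im + 1) * (Real.exp u.re * Real.cos u.im + 1) +
        (Real.exp u.re * Real.sin u.im + 0) * (Real.exp u.re * Real.sin u.im + 0) =
        Real.exp u.re ^ 2 + 2 * (Real.exp u.re * Real.cos u.im) + 1 := by
      linear_combination Real.exp u.re ^ 2 * hsc
    rw [this]
    have h5 : Real.exp u.re * (-(1 / 2) + t / 2) ≤ Real.exp u.re * Real.cos u.im := by gcongr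
    have h6 : |u.re| ≤ t / 16 := by linarith
    nlinarith [abs_nonneg u.re]
  have hexp : Real.exp (3 / 16 * t) ≤ 1 + 3 / 8 * t := by
    have := Real.abs_exp_sub_one_le (x := 3 / 16 * t) (by rw [abs_of_nonneg] <;> linarith)
    rw [abs_of_nonneg (by linarith : 0 ≤ 3 / 16 * t)] at this
    linarith [le_abs_self (Real.exp (3 / 16 * t) - 1)]
  refine le_of_sq_le_sq ?_ (by positivity)
  calc Real.exp (6 * L) ^ 2 = Real.exp (12 * L) := by
        rw [← Real.exp_nat_mul]; congr 1; push_cast; ring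
    _ ≤ Real.exp (k * (3 / 16 * t)) := by
        apply Real.exp_le_exp.2
        have : k * (64 * (L / k)) ≤ k * t := by gcongr
        rw [show k * (64 * (L / k)) = 64 * L by field_simp] at this
        linarith
    _ = Real.exp (3 / 16 * t) ^ k := Real.exp_nat_mul _ _
    _ ≤ (‖Complex.exp u + 1‖ ^ 2) ^ k := by gcongr; exact hexp.trans hsq
    _ = _ := by rw [← pow_mul, ← pow_mul, mul_comm]

/-- A phase function `Ψ`: on the box, `E(exp u) = 2 (cos 2πa exp (Ψ u) + cos 2πb exp (-ku))`. -/
structure IsPhase (k : ℕ) (a b L : ℝ) (Ψ : ℂ → ℂ) : Prop where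
  diff : DifferentiableOn ℂ Ψ (logBox k L)
  norm_le : ∀ u ∈ logBox k L, ‖Ψ u‖ ≤ Real.exp (-(3 * L))
  eq : ∀ u ∈ logBox k L, eisenstein k a b (Complex.exp u) =
    2 * (cosTurn a * Complex.exp (Ψ u) + cosTurn b * Complex.exp (-(k * u)))

lemma LargeWeight.cosTurn_ne_zero (h : LargeWeight k a b L) :
    (cosTurn a : ℂ) ≠ 0 ∧ (cosTurn b : ℂ) ≠ 0 := by
  have ha := h.left_ge
  have hb := h.right_ge
  have := Real.exp_pos (-L)
  constructor
  · rw [Complex.ofReal_ne_zero, ← abs_pos]; linarith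
  · rw [Complex.ofReal_ne_zero, ← abs_pos]; linarith

/-- Dividing by `cos 2πa` costs a factor `e^L`, so the third term and the remainder, both
`O(e^{-6L})`, leave a relative error `q = O(e^{-5L})`. Then `Ψ = log(1 + q)` on the principal
branch. -/
lemma LargeWeight.exists_phase (h : LargeWeight k a b L) : ∃ Ψ, IsPhase k a b L Ψ := by
  obtain ⟨ha0, hb0⟩ := h.cosTurn_ne_zero
  set q : ℂ → ℂ := fun u ↦ (eisenstein k a b (Complex.exp u) / 2 - cosTurn a -
    cosTurn b * Complex.exp (-(k * u))) / cosTurn a with hq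
  have hE {u : ℂ} (hu : u ∈ logBox k L) : DifferentiableAt ℂ q u := by
    have h1 : DifferentiableAt ℂ (eisenstein k a b) (Complex.exp u) :=
      (differentiableOn_eisenstein h.three_le a b).differentiableAt
        (isOpen_leftRegion.mem_nhds (h.exp_mem_leftRegion hu))
    have h2 : DifferentiableAt ℂ (fun u ↦ eisenstein k a b (Complex.exp u)) u :=
      h1.comp u Complex.differentiableAt_exp
    rw [hq]
    fun_prop
  have hpos := Real.exp_pos (-L)
  have hx := exp_neg_mul_le h.one_le
  have h3 : Real.exp (-(3 * L)) = Real.exp (-L) ^ 3 := by exact_mod_cast exp_neg_nat_mul 3 L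
  have h6 : Real.exp (-(6 * L)) = Real.exp (-L) ^ 6 := by exact_mod_cast exp_neg_nat_mul 6 L
  have hb {u : ℂ} (hu : u ∈ logBox k L) : ‖q u‖ ≤ 3 / 2 * Real.exp (-L) ^ 5 := by
    have hr := h.remainder_le _ (h.exp_mem_leftRegion hu)
    have hp := h.norm_exp_add_one_pow_ge hu
    have e1 : Complex.exp (-(k * u)) = 1 / Complex.exp u ^ k := by
      rw [Complex.exp_neg, Complex.exp_nat_mul, one_div]
    have e2 : q u = ((eisenstein k a b (Complex.exp u) - 2 * mainPart k a b (Complex.exp u)) / 2 +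
        cosTurn (a - b) / (Complex.exp u + 1) ^ k) / cosTurn a := by
      rw [hq, mainPart]
      simp only [e1]
      ring
    rw [e2, norm_div, Complex.norm_real, Real.norm_eq_abs, div_le_iff₀ (by linarith [h.left_ge])]
    have e3 : ‖(cosTurn (a - b) / (Complex.exp u + 1) ^ k : ℂ)‖ ≤ Real.exp (-(6 * L)) := by
      rw [norm_div, norm_pow, Complex.norm_real, Real.norm_eq_abs, Real.exp_neg, ← one_div]
      gcongr
      exact abs_cosTurn_le _
    refine (norm_add_le _ _).trans ?_
    rw [norm_div, Complex.norm_ofNat]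
    rw [h6] at hr e3
    have : Real.exp (-L) ^ 5 * Real.exp (-L) ≤ Real.exp (-L) ^ 5 * |cosTurn a| := by
      gcongr; exact h.left_ge
    have e : Real.exp (-L) ^ 6 = Real.exp (-L) ^ 5 * Real.exp (-L) := pow_succ _ _
    linarith
  have hsmall {u : ℂ} (hu : u ∈ logBox k L) : ‖q u‖ ≤ 1 / 2 := by
    refine (hb hu).trans ?_
    have := pow_le_pow_left₀ hpos.le hx 5
    norm_num at this ⊢
    linarith
  have hslit {u : ℂ} (hu : u ∈ logBox k L) : 1 + q u ∈ Complex.slitPlane := by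
    left
    have := (abs_le.1 ((Complex.abs_re_le_norm (q u)).trans (hsmall hu))).1
    simp only [Complex.add_re, Complex.one_re]
    linarith
  refine ⟨fun u ↦ Complex.log (1 + q u), ?_, ?_, ?_⟩
  · intro u hu
    exact ((differentiableAt_const _).fun_add (hE hu)).clog (hslit hu) |>.differentiableWithinAt
  · intro u hu
    refine (Complex.norm_log_one_add_half_le_self (hsmall hu)).trans ?_
    rw [h3]
    have := hb hu
    have : Real.exp (-L) ^ 5 ≤ 0.136 * Real.exp (-L) ^ 3 := by
      have : Real.exp (-L) ^ 2 ≤ 0.136 := by nlinarith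
      have e : Real.exp (-L) ^ 5 = Real.exp (-L) ^ 2 * Real.exp (-L) ^ 3 := by ring
      rw [e]
      gcongr
    nlinarith [pow_pos hpos 3]
  · intro u hu
    rw [Complex.exp_log (Complex.slitPlane_ne_zero (hslit hu)), hq]
    field_simp
    ring

lemma LargeWeight.exp_three_le (h : LargeWeight k a b L) : Real.exp (-(3 * L)) ≤ 1 / 20 := by
  have h3 : Real.exp (-(3 * L)) = Real.exp (-L) ^ 3 := by exact_mod_cast exp_neg_nat_mul 3 L
  have hx := exp_neg_mul_le h.one_le
  rw [h3]
  refine (pow_le_pow_left₀ (Real.exp_pos _).le hx 3).trans (by norm_num)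

/-- Cauchy's estimate gives `k e^{-3L} ≤ k/20`. Any bound below `k` makes `u ↦ ku + Ψ(u)` injective.
-/
lemma IsPhase.norm_deriv_le {Ψ : ℂ → ℂ} (hΨ : IsPhase k a b L Ψ) (h : LargeWeight k a b L) {u : ℂ}
    (hu : u ∈ innerLogBox k L) : ‖deriv Ψ u‖ ≤ k / 2 := by
  have hk := h.weight_pos
  have hsub := h.closedBall_subset_logBox hu
  have hR : (0 : ℝ) < 1 / k := by positivity
  have := Complex.norm_deriv_le_of_forall_mem_sphere_norm_le (f := Ψ) hR
    ((hΨ.diff.mono hsub).diffContOnCl_ball le_rfl)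
    (fun z hz ↦ hΨ.norm_le z (hsub (Metric.sphere_subset_closedBall hz)))
  refine this.trans ?_
  rw [div_div_eq_mul_div, div_one]
  nlinarith [h.exp_three_le]

lemma IsPhase.differentiableAt {Ψ : ℂ → ℂ} (hΨ : IsPhase k a b L Ψ) {u : ℂ}
    (hu : u ∈ logBox k L) : DifferentiableAt ℂ Ψ u :=
  hΨ.diff.differentiableAt (isOpen_logBox.mem_nhds hu)

lemma IsPhase.lipschitz {Ψ : ℂ → ℂ} (hΨ : IsPhase k a b L Ψ) (h : LargeWeight k a b L) {u v : ℂ}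
    (hu : u ∈ innerLogBox k L) (hv : v ∈ innerLogBox k L) :
    ‖Ψ u - Ψ v‖ ≤ k / 2 * ‖u - v‖ :=
  convex_innerLogBox.norm_image_sub_le_of_norm_deriv_le
    (fun _ hx ↦ hΨ.differentiableAt (h.innerLogBox_subset hx))
    (fun _ hx ↦ hΨ.norm_deriv_le h hx) hv hu

end

section

variable {k : ℕ} {a b L : ℝ} {Ψ : ℂ → ℂ}

/-! ### Zeros away from `ρ` -/

/-- A logarithm of minus the ratio of the two main coefficients. -/
def logRatio (a b : ℝ) : ℂ := Complex.log (-(cosTurn b / cosTurn a))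

lemma LargeWeight.exp_logRatio (h : LargeWeight k a b L) :
    Complex.exp (logRatio a b) = -(cosTurn b / cosTurn a) := by
  obtain ⟨ha, hb⟩ := h.cosTurn_ne_zero
  exact Complex.exp_log (neg_ne_zero.2 (div_ne_zero hb ha))

lemma logRatio_re (a b : ℝ) : (logRatio a b).re = Real.log (|cosTurn b| / |cosTurn a|) := by
  simp [logRatio, Complex.log_re]

lemma LargeWeight.abs_logRatio_re_le (h : LargeWeight k a b L) : |(logRatio a b).re| ≤ L := by
  have hp := Real.exp_pos (-L)
  have ha := h.left_ge
  have hb := h.right_ge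
  have hlog {x : ℝ} (hx : Real.exp (-L) ≤ |cosTurn x|) :
      -L ≤ Real.log |cosTurn x| ∧ Real.log |cosTurn x| ≤ 0 :=
    ⟨(Real.le_log_iff_exp_le (hp.trans_le hx)).2 hx,
      Real.log_nonpos (abs_nonneg _) (abs_cosTurn_le x)⟩
  rw [logRatio_re, Real.log_div (by linarith) (by linarith), abs_le]
  constructor <;> linarith [(hlog ha).1, (hlog ha).2, (hlog hb).1, (hlog hb).2]

/-- The logarithmic equation for the zero of index `j`. -/
def IsZeroIndex (k : ℕ) (a b : ℝ) (Ψ : ℂ → ℂ) (u : ℂ) (j : ℤ) : Prop :=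
  k * u + Ψ u = logRatio a b + j * (2 * Real.pi * Complex.I)

lemma IsPhase.eq_zero_iff (hΨ : IsPhase k a b L Ψ) (h : LargeWeight k a b L) {u : ℂ}
    (hu : u ∈ logBox k L) :
    eisenstein k a b (Complex.exp u) = 0 ↔ ∃ j, IsZeroIndex k a b Ψ u j := by
  obtain ⟨ha, hb⟩ := h.cosTurn_ne_zero
  simp only [IsZeroIndex]
  rw [← Complex.exp_eq_exp_iff_exists_int, h.exp_logRatio, hΨ.eq u hu, Complex.exp_add,
    Complex.exp_neg]
  have := Complex.exp_ne_zero (k * u)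
  rw [mul_eq_zero_iff_left two_ne_zero]
  field_simp
  exact ⟨fun h ↦ by linear_combination h, fun h ↦ by linear_combination h⟩

lemma IsZeroIndex.re_eq {u : ℂ} {j : ℤ} (hj : IsZeroIndex k a b Ψ u j) :
    k * u.re + (Ψ u).re = (logRatio a b).re := by
  have := congrArg Complex.re hj
  simpa using this

lemma IsZeroIndex.im_eq {u : ℂ} {j : ℤ} (hj : IsZeroIndex k a b Ψ u j) :
    k * u.im + (Ψ u).im = (logRatio a b).im + 2 * Real.pi * j := by
  have := congrArg Complex.im hj
  simp at this
  linarith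

lemma IsZeroIndex.unique (hΨ : IsPhase k a b L Ψ) (h : LargeWeight k a b L) {u v : ℂ}
    (hu : u ∈ innerLogBox k L) (hv : v ∈ innerLogBox k L) {j : ℤ}
    (hju : IsZeroIndex k a b Ψ u j) (hjv : IsZeroIndex k a b Ψ v j) : u = v := by
  have hk := h.weight_pos
  have e : (k : ℂ) * (u - v) = -(Ψ u - Ψ v) := by
    unfold IsZeroIndex at hju hjv
    linear_combination hju - hjv
  have e' := congrArg norm e
  rw [norm_mul, norm_neg, Complex.norm_natCast] at e'
  have := hΨ.lipschitz h hu hv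
  have h0 : ‖u - v‖ = 0 := by nlinarith [norm_nonneg (u - v)]
  exact sub_eq_zero.1 (norm_eq_zero.1 h0)

/-- The zero is the fixed point of `u ↦ (c - Ψ(u))/k`, a contraction of the disc of radius `1/(2k)`
about `c/k`, where `c` is the right-hand side of the logarithmic equation. -/
lemma IsPhase.exists_zero (hΨ : IsPhase k a b L Ψ) (h : LargeWeight k a b L) {j : ℤ}
    (h1 : k * (Real.pi / 2) ≤ (logRatio a b).im + 2 * Real.pi * j)
    (h2 : (logRatio a b).im + 2 * Real.pi * j ≤ k * (2 * Real.pi / 3 - 66 * (L / k))) :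
    ∃ u ∈ innerLogBox k L, IsZeroIndex k a b Ψ u j := by
  have hk := h.weight_pos
  have hk' : (k : ℂ) ≠ 0 := by exact_mod_cast hk.ne'
  set c : ℂ := logRatio a b + j * (2 * Real.pi * Complex.I) with hc
  have hcre : c.re = (logRatio a b).re := by simp [hc]
  have hcim : c.im = (logRatio a b).im + 2 * Real.pi * j := by simp [hc]; ring
  set s : Set ℂ := Metric.closedBall (c / k) (1 / (2 * k)) with hs
  have hbox : s ⊆ innerLogBox k L := by
    intro v hv
    rw [hs, Metric.mem_closedBall, dist_eq_norm] at hv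
    have g1 := abs_le.1 ((Complex.abs_re_le_norm _).trans hv)
    have g2 := abs_le.1 ((Complex.abs_im_le_norm _).trans hv)
    simp only [Complex.sub_re, Complex.sub_im, Complex.div_natCast_re, Complex.div_natCast_im,
      hcre, hcim] at g1 g2
    have hL := abs_le.1 h.abs_logRatio_re_le
    have e1 : (logRatio a b).re / k ≤ L / k := by gcongr; exact hL.2
    have e2 : -(L / k) ≤ (logRatio a b).re / k := by
      rw [← neg_div]; gcongr; exact hL.1
    have e3 : Real.pi / 2 ≤ ((logRatio a b).im + 2 * Real.pi * j) / k := by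
      rw [le_div_iff₀ hk]; linarith
    have e4 : ((logRatio a b).im + 2 * Real.pi * j) / k ≤ 2 * Real.pi / 3 - 66 * (L / k) := by
      rw [div_le_iff₀ hk]; linarith
    have e5 : 1 / (2 * (k : ℝ)) = 1 / k / 2 := by field_simp
    have hi := h.inv_le
    have hi0 : 0 < 1 / (k : ℝ) := by positivity
    rw [e5] at g1 g2
    exact ⟨abs_lt.2 ⟨by linarith, by linarith⟩, by linarith, by linarith⟩
  set f : ℂ → ℂ := fun u ↦ (c - Ψ u) / k with hf
  have hmaps : Set.MapsTo f s s := by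
    intro u hu
    rw [hs, Metric.mem_closedBall, dist_eq_norm, hf]
    have : (c - Ψ u) / k - c / k = -(Ψ u) / k := by ring
    simp only [this, norm_div, norm_neg, Complex.norm_natCast]
    rw [div_le_div_iff₀ hk (by positivity)]
    nlinarith [hΨ.norm_le u (h.innerLogBox_subset (hbox hu)), h.exp_three_le]
  have hcontr : ContractingWith (1 / 2) (hmaps.restrict f s s) := by
    refine ⟨by rw [div_lt_one (by norm_num)]; norm_num, LipschitzWith.of_dist_le_mul ?_⟩
    rintro ⟨u, hu⟩ ⟨v, hv⟩
    simp only [Subtype.dist_eq, Set.MapsTo.val_restrict_apply, dist_eq_norm, hf]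
    have : (c - Ψ u) / k - (c - Ψ v) / k = -(Ψ u - Ψ v) / k := by ring
    rw [this, norm_div, norm_neg, Complex.norm_natCast, div_le_iff₀ hk]
    refine (hΨ.lipschitz h (hbox hu) (hbox hv)).trans (le_of_eq ?_)
    push_cast
    ring
  obtain ⟨u, hu, hfix, -⟩ := hcontr.exists_fixedPoint' (Metric.isClosed_closedBall.isComplete) hmaps
    (Metric.mem_closedBall_self (by positivity)) (edist_ne_top _ _)
  refine ⟨u, hbox hu, ?_⟩
  have : (c - Ψ u) / k = u := hfix
  rw [div_eq_iff hk'] at this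
  rw [IsZeroIndex, ← hc]
  linear_combination -this

lemma LargeWeight.analyticAt (h : LargeWeight k a b L) {z : ℂ} (hz : z ∈ leftRegion) :
    AnalyticAt ℂ (eisenstein k a b) z :=
  (differentiableOn_eisenstein h.three_le a b).analyticAt (isOpen_leftRegion.mem_nhds hz)

lemma IsPhase.order_eq_one (hΨ : IsPhase k a b L Ψ) (h : LargeWeight k a b L) {u : ℂ}
    (hu : u ∈ innerLogBox k L) (h0 : eisenstein k a b (Complex.exp u) = 0) :
    analyticOrderNatAt (eisenstein k a b) (Complex.exp u) = 1 := by
  have hk := h.weight_pos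
  have hu' := h.innerLogBox_subset hu
  have han := h.analyticAt (h.exp_mem_leftRegion hu')
  suffices hd : deriv (eisenstein k a b) (Complex.exp u) ≠ 0 by
    rw [analyticOrderNatAt, han.analyticOrderAt_eq_one_of_zero_deriv_ne_zero h0 hd]
    rfl
  intro hd
  have d1 : HasDerivAt (fun v ↦ eisenstein k a b (Complex.exp v)) 0 u := by
    have := HasDerivAt.comp u (hd ▸ han.differentiableAt.hasDerivAt) (Complex.hasDerivAt_exp u)
    rw [zero_mul] at this
    exact this
  have d2 : HasDerivAt (fun v ↦ 2 * (cosTurn a * Complex.exp (Ψ v) +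
      cosTurn b * Complex.exp (-(k * v)))) (2 * (cosTurn a * (Complex.exp (Ψ u) * deriv Ψ u) +
      cosTurn b * (Complex.exp (-(k * u)) * -(k * 1)))) u :=
    (((hΨ.differentiableAt hu').hasDerivAt.cexp.const_mul _).add
      (((hasDerivAt_id u).const_mul _).neg.cexp.const_mul _)).const_mul _
  have d3 : HasDerivAt (fun v ↦ 2 * (cosTurn a * Complex.exp (Ψ v) +
      cosTurn b * Complex.exp (-(k * v)))) 0 u := by
    refine d1.congr_of_eventuallyEq ?_
    filter_upwards [isOpen_logBox.mem_nhds hu'] with v hv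
    exact (hΨ.eq v hv).symm
  have e := d2.unique d3
  rw [hΨ.eq u hu'] at h0
  -- Adding `k` times the equation `E = 0` eliminates the second term; a multiple zero would force
  -- `Ψ' = -k`.
  have e' : 2 * (cosTurn a * Complex.exp (Ψ u) * (deriv Ψ u + k)) = 0 := by
    linear_combination e + k * h0
  have hne : deriv Ψ u + k = 0 := by
    simpa [h.cosTurn_ne_zero.1, Complex.exp_ne_zero] using e'
  have hn := hΨ.norm_deriv_le h hu
  rw [eq_neg_of_add_eq_zero_left hne, norm_neg, Complex.norm_natCast] at hn
  linarith

lemma exp_three_lt_two_mul (hL : 1 ≤ L) : Real.exp (-(3 * L)) < 2 * Real.exp (-(2 * L)) := by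
  have : Real.exp (-(3 * L)) ≤ Real.exp (-(2 * L)) := Real.exp_le_exp.2 (by linarith)
  linarith [Real.exp_pos (-(2 * L))]

/-- The gap `2e^{-2L}` exceeds `‖Ψ‖ ≤ e^{-3L}`, so `Re u` inherits the sign of the logarithm of the
ratio. -/
lemma IsZeroIndex.re_pos (hΨ : IsPhase k a b L Ψ) (h : LargeWeight k a b L) {u : ℂ}
    (hu : u ∈ logBox k L) {j : ℤ} (hj : IsZeroIndex k a b Ψ u j)
    (hgap : 2 * Real.exp (-(2 * L)) ≤ (logRatio a b).re) : 0 < u.re := by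
  have := hj.re_eq
  have h1 := (abs_le.1 ((Complex.abs_re_le_norm _).trans (hΨ.norm_le u hu))).2
  have h2 := exp_three_lt_two_mul h.one_le
  by_contra! h3
  nlinarith [h.weight_pos]

lemma IsZeroIndex.re_neg (hΨ : IsPhase k a b L Ψ) (h : LargeWeight k a b L) {u : ℂ}
    (hu : u ∈ logBox k L) {j : ℤ} (hj : IsZeroIndex k a b Ψ u j)
    (hgap : (logRatio a b).re ≤ -(2 * Real.exp (-(2 * L)))) : u.re < 0 := by
  have := hj.re_eq
  have h1 := (abs_le.1 ((Complex.abs_re_le_norm _).trans (hΨ.norm_le u hu))).1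
  have h2 := exp_three_lt_two_mul h.one_le
  by_contra! h3
  nlinarith [h.weight_pos]

/-- If the zeros are symmetric with respect to the unit circle, those near the arc lie on it. -/
lemma IsZeroIndex.re_eq_zero (hΨ : IsPhase k a b L Ψ) (h : LargeWeight k a b L) {u : ℂ}
    (hu : u ∈ innerLogBox k L) {j : ℤ} (hj : IsZeroIndex k a b Ψ u j)
    (hsym : ∀ z : ℂ, z ≠ 0 → eisenstein k a b z = 0 →
      eisenstein k a b ((starRingEnd ℂ) z)⁻¹ = 0) : u.re = 0 := by
  -- Reflection in the circle becomes `u ↦ -ū`. It keeps the imaginary part, so both zeros have the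
  -- same index and coincide by uniqueness.
  set v := -(starRingEnd ℂ) u with hv
  have hvre : v.re = -u.re := by simp [hv]
  have hvim : v.im = u.im := by simp [hv]
  have hvbox : v ∈ innerLogBox k L := by
    obtain ⟨h1, h2, h3⟩ := hu
    refine ⟨?_, ?_, ?_⟩
    · rwa [hvre, abs_neg]
    · rwa [hvim]
    · rwa [hvim]
  have hu' := h.innerLogBox_subset hu
  have hv' := h.innerLogBox_subset hvbox
  have hz := hsym _ (Complex.exp_ne_zero u) ((hΨ.eq_zero_iff h hu').2 ⟨j, hj⟩)
  rw [← Complex.exp_conj, ← Complex.exp_neg, ← hv] at hz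
  obtain ⟨i, hi⟩ := (hΨ.eq_zero_iff h hv').1 hz
  have e1 := hj.im_eq
  have e2 := hi.im_eq
  rw [hvim] at e2
  have g1 := abs_le.1 ((Complex.abs_im_le_norm _).trans (hΨ.norm_le u hu'))
  have g2 := abs_le.1 ((Complex.abs_im_le_norm _).trans (hΨ.norm_le v hv'))
  have g := h.exp_three_le
  have hpi := Real.pi_gt_three
  have hij : i = j := by
    have a1 : (i : ℝ) - j < 1 := by
      by_contra! hc
      nlinarith
    have a2 : (j : ℝ) - i < 1 := by
      by_contra! hc
      nlinarith
    have b1 : i - j < 1 := by exact_mod_cast a1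
    have b2 : j - i < 1 := by exact_mod_cast a2
    omega
  subst hij
  have := congrArg Complex.re (IsZeroIndex.unique hΨ h hu hvbox hj hi)
  rw [hvre] at this
  linarith

lemma le_arg_of_mem_leftHalf {z : ℂ} (hz : z ∈ leftHalf) :
    Real.pi / 2 ≤ z.arg ∧ z.arg ≤ 2 * Real.pi / 3 := by
  obtain ⟨h1, h2, h3, h4⟩ := hz
  have hz0 : z ≠ 0 := by
    rintro rfl; simp at h1
  have harg0 : 0 ≤ z.arg := Complex.arg_nonneg_iff.2 h1.le
  have hargpi := Complex.arg_le_pi z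
  have hcos : ‖z‖ * Real.cos z.arg = z.re := Complex.norm_mul_cos_arg z
  have hn : 0 < ‖z‖ := by linarith
  constructor
  · by_contra! h
    have := Real.cos_pos_of_mem_Ioo ⟨by linarith [Real.pi_pos], h⟩
    nlinarith
  · by_contra! h
    have h5 := Real.cos_lt_cos_of_nonneg_of_le_pi (by positivity) hargpi h
    rw [show 2 * Real.pi / 3 = Real.pi - Real.pi / 3 by ring, Real.cos_pi_sub,
      Real.cos_pi_div_three] at h5
    nlinarith

lemma LargeWeight.re_log_lt (h : LargeWeight k a b L) {z : ℂ} (hz : z ∈ leftHalf)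
    (h0 : eisenstein k a b z = 0) :
    0 ≤ (Complex.log z).re ∧ (Complex.log z).re < 3 * (L / k) := by
  have hk := h.weight_pos
  have hn := hz.2.1
  rw [Complex.log_re]
  refine ⟨Real.log_nonneg hn, ?_⟩
  by_contra! hc
  have : Real.exp (3 * L) ≤ ‖z‖ ^ k := by
    rw [← Real.exp_log (by linarith : 0 < ‖z‖), ← Real.exp_nat_mul]
    apply Real.exp_le_exp.2
    calc 3 * L = k * (3 * (L / k)) := by field_simp
      _ ≤ _ := by gcongr
  have := h.lower_bound hz this
  rw [h0, norm_zero] at this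
  linarith [Real.exp_pos (-L)]

lemma LargeWeight.log_mem_innerLogBox (h : LargeWeight k a b L) {z : ℂ} (hz : z ∈ leftHalf)
    (h0 : eisenstein k a b z = 0) (harg : z.arg ≤ 2 * Real.pi / 3 - 66 * (L / k)) :
    Complex.log z ∈ innerLogBox k L := by
  obtain ⟨h1, h2⟩ := h.re_log_lt hz h0
  have h3 := (le_arg_of_mem_leftHalf hz).1
  have hk := h.weight_pos
  have hi : 0 < 1 / (k : ℝ) := by positivity
  have hi' := h.inv_le
  refine ⟨?_, ?_, ?_⟩
  · rwa [abs_of_nonneg h1]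
  · rw [Complex.log_im]; linarith
  · rw [Complex.log_im]; linarith

lemma ne_zero_of_mem_leftHalf {z : ℂ} (hz : z ∈ leftHalf) : z ≠ 0 := by
  rintro rfl
  simpa using hz.1

end

/-! ### Zeros near `ρ`, by Jensen's formula -/

section

/-- Jensen's bound for the zeros in a disc, counted with their orders. -/
lemma sum_analyticOrderNatAt_le {f : ℂ → ℂ} {c : ℂ} {r R M : ℝ} (hr : 0 < r) (hrR : r < R)
    (hM : 1 ≤ M) (hf : AnalyticOnNhd ℂ f (Metric.closedBall c R)) (hc : f c ≠ 0)
    (hb : ∀ z ∈ Metric.closedBall c R, ‖f z‖ ≤ M) :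
    {z ∈ Metric.closedBall c r | f z = 0}.Finite ∧
      ∀ s : Finset ℂ, (s : Set ℂ) ⊆ Metric.closedBall c r →
        ∑ z ∈ s, (analyticOrderNatAt f z : ℝ) ≤ Real.log (M / ‖f c‖) / Real.log (R / r) := by
  have hR : 0 < R := hr.trans hrR
  have hfr : AnalyticOnNhd ℂ f (Metric.closedBall c r) :=
    hf.mono (Metric.closedBall_subset_closedBall hrR.le)
  -- `analyticOrderNatAt` would be `0` at a point of infinite order; connectedness and `f c ≠ 0`
  -- exclude this.
  have hord {z : ℂ} (hz : z ∈ Metric.closedBall c r) : analyticOrderAt f z ≠ ⊤ := by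
    have hcm : c ∈ Metric.closedBall c r := Metric.mem_closedBall_self hr.le
    refine hfr.analyticOrderAt_ne_top_of_isPreconnected
      (convex_closedBall c r).isPreconnected hcm hz ?_
    rw [(hfr c hcm).analyticOrderAt_eq_zero.2 hc]
    exact ENat.zero_ne_top
  set D := MeromorphicOn.divisor f (Metric.closedBall c r) with hD
  have hDfin : D.support.Finite := D.finiteSupport (isCompact_closedBall c r)
  have hDz {z : ℂ} (hz : z ∈ Metric.closedBall c r) : D z = analyticOrderNatAt f z := by
    rw [hD, MeromorphicOn.divisor_apply hfr.meromorphicOn hz, (hfr z hz).meromorphicOrderAt_eq,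
      ← Nat.cast_analyticOrderNatAt (hord hz)]
    rfl
  constructor
  · refine hDfin.subset ?_
    rintro z ⟨hz, h0⟩
    rw [Function.mem_support, hDz hz]
    have h1 : analyticOrderAt f z ≠ 0 := (hfr z hz).analyticOrderAt_ne_zero.2 h0
    rw [← Nat.cast_analyticOrderNatAt (hord hz)] at h1
    exact_mod_cast h1
  · intro s hs
    have hJ := AnalyticOnNhd.sum_divisor_le (f := f) (c := c) (r := r) (R := R) (M := M)
      (by rwa [abs_of_pos hr]) (by rwa [abs_of_pos hr, abs_of_pos hR]) hM
      (by rwa [abs_of_pos hR]) hc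
      (fun z hz ↦ hb z (by rw [abs_of_pos hR] at hz; exact Metric.sphere_subset_closedBall hz))
    rw [abs_of_pos hr, ← hD] at hJ
    refine le_trans ?_ hJ
    have hDnn (z : ℂ) : 0 ≤ D z := by
      by_cases hz : z ∈ Metric.closedBall c r
      · rw [hDz hz]; positivity
      · rw [D.apply_eq_zero_of_notMem hz]
    have h1 : ∑ z ∈ s, (analyticOrderNatAt f z : ℤ) ≤ ∑ᶠ z, D z := by
      rw [finsum_eq_sum_of_support_subset (s := s ∪ hDfin.toFinset) _ (by intro z hz; simp_all)]
      calc ∑ z ∈ s, (analyticOrderNatAt f z : ℤ) = ∑ z ∈ s, D z :=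
            Finset.sum_congr rfl fun z hz ↦ (hDz (hs hz)).symm
        _ ≤ _ := Finset.sum_le_sum_of_subset_of_nonneg Finset.subset_union_left
            (fun z _ _ ↦ hDnn z)
    exact_mod_cast h1

variable {k : ℕ} {a b L : ℝ}

lemma exp_neg_two_mul_le {y : ℝ} (h0 : 0 ≤ y) (h1 : y ≤ 1 / 4) : Real.exp (-(2 * y)) ≤ 1 - y := by
  have h2 := Real.add_one_le_exp (2 * y)
  rw [Real.exp_neg]
  rw [inv_le_comm₀ (Real.exp_pos _) (by linarith)]
  refine le_trans ?_ h2
  rw [inv_le_iff_one_le_mul₀ (by linarith)]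
  nlinarith

lemma rho_eq : rho = Complex.exp ((2 * Real.pi / 3 : ℝ) * Complex.I) := by
  rw [rho]; congr 1; push_cast; ring

lemma rho_re : rho.re = -(1 / 2) := by
  rw [rho_eq, Complex.exp_ofReal_mul_I_re, show 2 * Real.pi / 3 = Real.pi - Real.pi / 3 by ring,
    Real.cos_pi_sub, Real.cos_pi_div_three]

lemma rho_im : rho.im = √3 / 2 := by
  rw [rho_eq, Complex.exp_ofReal_mul_I_im, show 2 * Real.pi / 3 = Real.pi - Real.pi / 3 by ring,
    Real.sin_pi_sub, Real.sin_pi_div_three]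

lemma norm_rho : ‖rho‖ = 1 := by rw [rho_eq, Complex.norm_exp_ofReal_mul_I]

lemma norm_rho_add_one : ‖rho + 1‖ = 1 := by
  rw [← sq_eq_sq₀ (norm_nonneg _) zero_le_one, ← Complex.normSq_eq_norm_sq, Complex.normSq_apply]
  simp only [Complex.add_re, Complex.add_im, Complex.one_re, Complex.one_im, rho_re, rho_im]
  nlinarith [Real.sq_sqrt (show (0 : ℝ) ≤ 3 by norm_num)]

/-- A point above `ρ` at distance `8L/k`, at which the Eisenstein series is not small. -/
def cornerCentre (k : ℕ) (L : ℝ) : ℂ := rho + (8 * (L / k) : ℝ) * Complex.I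

lemma LargeWeight.scale_nonneg (h : LargeWeight k a b L) : 0 ≤ L / k :=
  div_nonneg (by linarith [h.one_le]) h.weight_pos.le

lemma norm_cornerCentre_sub (h : LargeWeight k a b L) :
    ‖cornerCentre k L - rho‖ = 8 * (L / k) := by
  rw [cornerCentre, add_sub_cancel_left, norm_mul, Complex.norm_I, mul_one, Complex.norm_real,
    Real.norm_eq_abs, abs_of_nonneg (by linarith [h.scale_nonneg])]

lemma norm_sub_rho_le (h : LargeWeight k a b L) {z : ℂ}
    (hz : z ∈ Metric.closedBall (cornerCentre k L) (300 * (L / k))) :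
    ‖z - rho‖ ≤ 308 * (L / k) := by
  rw [Metric.mem_closedBall, dist_eq_norm] at hz
  have := norm_add_le (z - cornerCentre k L) (cornerCentre k L - rho)
  rw [sub_add_sub_cancel, norm_cornerCentre_sub h] at this
  linarith

lemma LargeWeight.cornerBall_subset (h : LargeWeight k a b L) :
    Metric.closedBall (cornerCentre k L) (300 * (L / k)) ⊆ leftRegion := by
  intro z hz
  have hd := h.div_le
  have h1 := norm_sub_rho_le h hz
  have h2 := abs_le.1 ((Complex.abs_re_le_norm _).trans h1)
  have h3 := abs_le.1 ((Complex.abs_im_le_norm _).trans h1)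
  simp only [Complex.sub_re, Complex.sub_im, rho_re, rho_im] at h2 h3
  have h4 : (1.7 : ℝ) ≤ √3 := Real.le_sqrt_of_sq_le (by norm_num)
  have h5 : 1 - 308 * (L / k) ≤ ‖z‖ := by
    have := norm_sub_norm_le rho (rho - z)
    rw [sub_sub_cancel, norm_rho, norm_sub_rev] at this
    linarith
  refine ⟨by linarith, by linarith, by linarith, ?_⟩
  rw [Complex.normSq_eq_norm_sq]
  nlinarith

/-- Both `‖z‖` and `‖z + 1‖` are at least `1 - 308L/k ≥ e^{-616L/k}`, so each main term is at most
`e^{616L}`. -/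
lemma LargeWeight.corner_upper_bound (h : LargeWeight k a b L) {z : ℂ}
    (hz : z ∈ Metric.closedBall (cornerCentre k L) (300 * (L / k))) :
    ‖eisenstein k a b z‖ ≤ 7 * Real.exp (616 * L) := by
  have hd := h.div_le
  have hs := h.scale_nonneg
  have hk := h.weight_pos
  have h1 := norm_sub_rho_le h hz
  have hr := h.remainder_le z (h.cornerBall_subset hz)
  have hr' : Real.exp (-(6 * L)) ≤ 1 := Real.exp_le_one_iff.2 (by linarith [h.one_le])
  have hE : 1 ≤ Real.exp (616 * L) := Real.one_le_exp (by linarith [h.one_le])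
  have hpow {w : ℂ} (hw : 1 - 308 * (L / k) ≤ ‖w‖) (c : ℝ) :
      ‖(cosTurn c : ℂ) / w ^ k‖ ≤ Real.exp (616 * L) := by
    rw [norm_div, norm_pow, Complex.norm_real, Real.norm_eq_abs]
    have e1 : Real.exp (-(616 * L)) ≤ ‖w‖ ^ k := by
      calc Real.exp (-(616 * L)) = Real.exp (-(2 * (308 * (L / k)))) ^ k := by
            rw [← Real.exp_nat_mul]; congr 1; field_simp; ring
        _ ≤ ‖w‖ ^ k := by
            gcongr
            exact (exp_neg_two_mul_le (by linarith) (by linarith)).trans hw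
    calc |cosTurn c| / ‖w‖ ^ k ≤ 1 / Real.exp (-(616 * L)) := by
          gcongr
          exact abs_cosTurn_le c
      _ = _ := by rw [Real.exp_neg, one_div, inv_inv]
  have g1 : 1 - 308 * (L / k) ≤ ‖z‖ := by
    have := norm_sub_norm_le rho (rho - z)
    rw [sub_sub_cancel, norm_rho, norm_sub_rev] at this
    linarith
  have g2 : 1 - 308 * (L / k) ≤ ‖z + 1‖ := by
    have := norm_sub_norm_le (rho + 1) (rho - z)
    rw [show rho + 1 - (rho - z) = z + 1 by ring, norm_rho_add_one, norm_sub_rev] at this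
    linarith
  have e1 := hpow g1 b
  have e2 := hpow g2 (a - b)
  have e3 : ‖(cosTurn a : ℂ)‖ ≤ 1 := by
    rw [Complex.norm_real, Real.norm_eq_abs]; exact abs_cosTurn_le a
  have e4 : ‖mainPart k a b z‖ ≤ 3 * Real.exp (616 * L) := by
    rw [mainPart]
    refine (norm_add₃_le).trans (by linarith)
  have e5 := norm_add_le (eisenstein k a b z - 2 * mainPart k a b z) (2 * mainPart k a b z)
  rw [sub_add_cancel, norm_mul, Complex.norm_ofNat] at e5
  linarith

/-- The centre satisfies `‖c‖² ≥ 1 + 8√3 L/k ≥ e^{8L/k}`, so `‖c‖^k ≥ e^{4L}` and the zero-free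
bound applies. -/
lemma LargeWeight.corner_lower_bound (h : LargeWeight k a b L) :
    Real.exp (-L) ≤ ‖eisenstein k a b (cornerCentre k L)‖ := by
  have hd := h.div_le
  have hs := h.scale_nonneg
  have hk := h.weight_pos
  have hre : (cornerCentre k L).re = -(1 / 2) := by simp [cornerCentre, rho_re]
  have him : (cornerCentre k L).im = √3 / 2 + 8 * (L / k) := by simp [cornerCentre, rho_im]
  have h4 : (1.7 : ℝ) ≤ √3 := Real.le_sqrt_of_sq_le (by norm_num)
  have hsq : Real.exp (8 * (L / k)) ≤ ‖cornerCentre k L‖ ^ 2 := by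
    rw [← Complex.normSq_eq_norm_sq, Complex.normSq_apply, hre, him]
    have := Real.abs_exp_sub_one_sub_id_le (x := 8 * (L / k))
      (by rw [abs_of_nonneg] <;> linarith)
    have := le_abs_self (Real.exp (8 * (L / k)) - 1 - 8 * (L / k))
    nlinarith [Real.sq_sqrt (show (0 : ℝ) ≤ 3 by norm_num)]
  have hn : 1 ≤ ‖cornerCentre k L‖ := by
    have : 1 ≤ Real.exp (8 * (L / k)) := Real.one_le_exp (by linarith)
    nlinarith [norm_nonneg (cornerCentre k L)]
  refine h.lower_bound ⟨by rw [him]; linarith, hn, by rw [hre], by rw [hre]; norm_num⟩ ?_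
  refine le_of_sq_le_sq ?_ (by positivity)
  calc Real.exp (3 * L) ^ 2 = Real.exp (6 * L) := by
        rw [← Real.exp_nat_mul]; congr 1; push_cast; ring
    _ ≤ Real.exp (8 * L) := Real.exp_le_exp.2 (by linarith [h.one_le])
    _ = Real.exp (8 * (L / k)) ^ k := by rw [← Real.exp_nat_mul]; congr 1; field_simp
    _ ≤ (‖cornerCentre k L‖ ^ 2) ^ k := by gcongr
    _ = _ := by rw [← pow_mul, ← pow_mul, mul_comm]

/-- The zeros in the left half near `ρ`. -/
def cornerZeros (k : ℕ) (a b L : ℝ) : Set ℂ :=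
  {z | z ∈ leftHalf ∧ eisenstein k a b z = 0 ∧ 2 * Real.pi / 3 - 66 * (L / k) < z.arg}

lemma LargeWeight.cornerZeros_subset (h : LargeWeight k a b L) :
    cornerZeros k a b L ⊆
      {z ∈ Metric.closedBall (cornerCentre k L) (150 * (L / k)) | eisenstein k a b z = 0} := by
  rintro z ⟨hz, h0, harg⟩
  refine ⟨?_, h0⟩
  have hd := h.div_le
  have hs := h.scale_nonneg
  obtain ⟨h1, h2⟩ := h.re_log_lt hz h0
  have h3 := (le_arg_of_mem_leftHalf hz).2
  -- The logarithms of `z` and `ρ` differ by at most `(3 + 66)L/k`; exponentiating at most doubles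
  -- this, and `138 + 8 ≤ 150`.
  set w : ℂ := Complex.log z - (2 * Real.pi / 3 : ℝ) * Complex.I with hw
  have hwn : ‖w‖ ≤ 69 * (L / k) := by
    have hre : w.re = (Complex.log z).re := by simp [hw]
    have him : w.im = z.arg - 2 * Real.pi / 3 := by simp [hw, Complex.log_im]
    refine (Complex.norm_le_abs_re_add_abs_im w).trans ?_
    rw [hre, him, abs_of_nonneg h1, abs_of_nonpos (by linarith)]
    linarith
  have hz' : z - rho = rho * (Complex.exp w - 1) := by
    rw [mul_sub, mul_one, rho_eq, ← Complex.exp_add, hw, add_sub_cancel,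
      Complex.exp_log (ne_zero_of_mem_leftHalf hz)]
  have hzn : ‖z - rho‖ ≤ 138 * (L / k) := by
    rw [hz', norm_mul, norm_rho, one_mul]
    have := Complex.norm_exp_sub_one_le (x := w) (by linarith)
    linarith
  rw [Metric.mem_closedBall, dist_eq_norm]
  have := norm_add_le (z - rho) (rho - cornerCentre k L)
  rw [sub_add_sub_cancel, norm_sub_rev rho, norm_cornerCentre_sub h] at this
  linarith

/-- Jensen's bound with radii in ratio 2: the logarithm is at most `619L`, and `619 / log 2 < 900`.
-/
lemma LargeWeight.corner_count (h : LargeWeight k a b L) :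
    (cornerZeros k a b L).Finite ∧ ∀ s : Finset ℂ, (s : Set ℂ) ⊆ cornerZeros k a b L →
      ∑ z ∈ s, (analyticOrderNatAt (eisenstein k a b) z : ℝ) ≤ 900 * L := by
  have hk := h.weight_pos
  have hL := h.one_le
  have hs : 0 < L / k := by positivity
  have hlow := h.corner_lower_bound
  have hpos := Real.exp_pos (-L)
  have hne : eisenstein k a b (cornerCentre k L) ≠ 0 := norm_pos_iff.1 (hpos.trans_le hlow)
  have hE : 1 ≤ Real.exp (616 * L) := Real.one_le_exp (by linarith)
  obtain ⟨h1, h2⟩ := sum_analyticOrderNatAt_le (f := eisenstein k a b) (c := cornerCentre k L)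
    (r := 150 * (L / k)) (R := 300 * (L / k)) (M := 7 * Real.exp (616 * L)) (by positivity)
    (by linarith) (by linarith) (fun z hz ↦ h.analyticAt (h.cornerBall_subset hz)) hne
    (fun z hz ↦ h.corner_upper_bound hz)
  refine ⟨h1.subset h.cornerZeros_subset, fun s hs' ↦ (h2 s fun z hz ↦
    (h.cornerZeros_subset (hs' hz)).1).trans ?_⟩
  have e1 : 300 * (L / k) / (150 * (L / k)) = 2 := by
    rw [mul_div_mul_right _ _ hs.ne']; norm_num
  rw [e1]
  have e2 : Real.log (7 * Real.exp (616 * L) / ‖eisenstein k a b (cornerCentre k L)‖) ≤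
      619 * L := by
    rw [Real.log_le_iff_le_exp (by positivity), div_le_iff₀ (norm_pos_iff.2 hne)]
    calc 7 * Real.exp (616 * L) ≤ Real.exp (2 * L) * Real.exp (616 * L) := by
          gcongr
          have : Real.exp 2 ≤ Real.exp (2 * L) := Real.exp_le_exp.2 (by linarith)
          have h3 : Real.exp 2 = Real.exp 1 ^ 2 := by rw [← Real.exp_nat_mul]; norm_num
          have := Real.exp_one_gt_d9
          nlinarith
      _ = Real.exp (619 * L) * Real.exp (-L) := by
          rw [← Real.exp_add, ← Real.exp_add]; congr 1; ring
      _ ≤ _ := by gcongr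
  have e3 := Real.log_two_gt_d9
  rw [div_le_iff₀ (by linarith)]
  nlinarith

end

/-! ### Counting the zeros of one series -/

section

variable {k : ℕ} {a b L θ₁ θ₂ : ℝ} {Ψ : ℂ → ℂ}

lemma mem_arc_bounds {z : ℂ} (hz : z ∈ arc) : 0 < z.im ∧ ‖z‖ = 1 ∧ -(1 / 2) ≤ z.re ∧ z.re ≤ 0 := by
  obtain ⟨θ, h1, h2, rfl⟩ := hz
  have hpi := Real.pi_pos
  rw [Complex.exp_ofReal_mul_I_im, Complex.exp_ofReal_mul_I_re, Complex.norm_exp_ofReal_mul_I]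
  refine ⟨Real.sin_pos_of_pos_of_lt_pi (by linarith) (by linarith), rfl, ?_, ?_⟩
  · have := Real.cos_le_cos_of_nonneg_of_le_pi (by linarith) (by linarith) h2
    rwa [show 2 * Real.pi / 3 = Real.pi - Real.pi / 3 by ring, Real.cos_pi_sub,
      Real.cos_pi_div_three] at this
  · exact Real.cos_nonpos_of_pi_div_two_le_of_le h1 (by linarith)

lemma mem_fundDomain_bounds {z : ℂ} (hz : z ∈ fundDomain) :
    0 < z.im ∧ 1 ≤ ‖z‖ ∧ -(1 / 2) ≤ z.re ∧ z.re < 1 / 2 := by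
  rcases hz with ⟨h1, h2, h3, h4⟩ | hz
  · exact ⟨h1, h2.le, h3, h4⟩
  · obtain ⟨h1, h2, h3, h4⟩ := mem_arc_bounds hz
    exact ⟨h1, h2.ge, h3, by linarith⟩

lemma mem_leftHalf_of_mem_fundDomain {z : ℂ} (hz : z ∈ fundDomain) (harg : Real.pi / 2 ≤ z.arg) :
    z ∈ leftHalf := by
  obtain ⟨h1, h2, h3, h4⟩ := mem_fundDomain_bounds hz
  refine ⟨h1, h2, h3, ?_⟩
  have := Real.cos_nonpos_of_pi_div_two_le_of_le harg
    (by linarith [Complex.arg_le_pi z, Real.pi_pos])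
  rw [← Complex.norm_mul_cos_arg z]
  exact mul_nonpos_of_nonneg_of_nonpos (norm_nonneg z) this

/-- The zeros in the left half with argument in `[θ₁, θ₂]`. -/
def windowZeros (k : ℕ) (a b θ₁ θ₂ : ℝ) : Set ℂ :=
  {z | z ∈ leftHalf ∧ eisenstein k a b z = 0 ∧ z.arg ∈ Set.Icc θ₁ θ₂}

lemma IsZeroIndex.abs_im_sub_le (hΨ : IsPhase k a b L Ψ) (h : LargeWeight k a b L) {u : ℂ}
    (hu : u ∈ innerLogBox k L) {j : ℤ} (hj : IsZeroIndex k a b Ψ u j) :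
    |k * u.im - (logRatio a b).im - 2 * Real.pi * j| ≤ 1 / 2 := by
  have h1 := (Complex.abs_im_le_norm _).trans (hΨ.norm_le u (h.innerLogBox_subset hu))
  have h2 := hj.im_eq
  rw [show k * u.im - (logRatio a b).im - 2 * Real.pi * j = -(Ψ u).im by linarith, abs_neg]
  linarith [h.exp_three_le]

lemma card_Icc_ceil_floor_le {x y : ℝ} (hxy : 0 ≤ y - x + 1) :
    ((Finset.Icc ⌈x⌉ ⌊y⌋).card : ℝ) ≤ y - x + 1 := by
  rw [Int.card_Icc]
  rcases le_total 0 (⌊y⌋ + 1 - ⌈x⌉) with h | h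
  · have : (((⌊y⌋ + 1 - ⌈x⌉).toNat : ℤ) : ℝ) = ⌊y⌋ + 1 - ⌈x⌉ := by
      rw [Int.toNat_of_nonneg h]; push_cast; ring
    rw [Int.cast_natCast] at this
    rw [this]
    linarith [Int.floor_le y, Int.le_ceil x]
  · rw [Int.toNat_of_nonpos h]
    simpa using hxy

lemma le_card_Icc_ceil_floor (x y : ℝ) : y - x - 1 ≤ ((Finset.Icc ⌈x⌉ ⌊y⌋).card : ℝ) := by
  rw [Int.card_Icc]
  have h : ((⌊y⌋ + 1 - ⌈x⌉ : ℤ) : ℝ) ≤ (((⌊y⌋ + 1 - ⌈x⌉).toNat : ℤ) : ℝ) := by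
    exact_mod_cast Int.self_le_toNat _
  rw [Int.cast_natCast] at h
  refine le_trans ?_ h
  push_cast
  linarith [Int.lt_floor_add_one y, Int.ceil_lt_add_one x]

/-- The index injects the zeros into an interval of integers; `|Im Ψ| ≤ 1/2` lengthens it by only
`1/(2π)`. -/
lemma LargeWeight.window_upper (h : LargeWeight k a b L) (h12 : θ₁ ≤ θ₂)
    (h2 : θ₂ ≤ 2 * Real.pi / 3 - 66 * (L / k)) :
    (windowZeros k a b θ₁ θ₂).Finite ∧ ∀ s : Finset ℂ, (s : Set ℂ) ⊆ windowZeros k a b θ₁ θ₂ →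
      (s.card : ℝ) ≤ k * (θ₂ - θ₁) / (2 * Real.pi) + 2 := by
  have hk := h.weight_pos
  have hpi := Real.pi_gt_three
  obtain ⟨Ψ, hΨ⟩ := h.exists_phase
  have hbox {z : ℂ} (hz : z ∈ windowZeros k a b θ₁ θ₂) : Complex.log z ∈ innerLogBox k L :=
    h.log_mem_innerLogBox hz.1 hz.2.1 (hz.2.2.2.trans h2)
  have hex : ∀ z ∈ windowZeros k a b θ₁ θ₂, ∃ j, IsZeroIndex k a b Ψ (Complex.log z) j := by
    intro z hz
    rw [← hΨ.eq_zero_iff h (h.innerLogBox_subset (hbox hz)),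
      Complex.exp_log (ne_zero_of_mem_leftHalf hz.1)]
    exact hz.2.1
  choose! J hJ using hex
  set x := (k * θ₁ - 1 / 2 - (logRatio a b).im) / (2 * Real.pi) with hx
  set y := (k * θ₂ + 1 / 2 - (logRatio a b).im) / (2 * Real.pi) with hy
  have hmaps : Set.MapsTo J (windowZeros k a b θ₁ θ₂) (Finset.Icc ⌈x⌉ ⌊y⌋) := by
    intro z hz
    have h3 := abs_le.1 ((hJ z hz).abs_im_sub_le hΨ h (hbox hz))
    rw [Complex.log_im] at h3
    have h4 : k * θ₁ ≤ k * z.arg := by gcongr; exact hz.2.2.1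
    have h5 : k * z.arg ≤ k * θ₂ := by gcongr; exact hz.2.2.2
    rw [Finset.coe_Icc, Set.mem_Icc, Int.ceil_le, Int.le_floor, hx, hy, div_le_iff₀ (by positivity),
      le_div_iff₀ (by positivity)]
    constructor <;> linarith
  have hinj : Set.InjOn J (windowZeros k a b θ₁ θ₂) := by
    intro z hz w hw hzw
    have := IsZeroIndex.unique hΨ h (hbox hz) (hbox hw) (hJ z hz) (hzw ▸ hJ w hw)
    rw [← Complex.exp_log (ne_zero_of_mem_leftHalf hz.1), this,
      Complex.exp_log (ne_zero_of_mem_leftHalf hw.1)]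
  refine ⟨Set.Finite.of_injOn hmaps hinj (Finset.finite_toSet _), fun s hs ↦ ?_⟩
  have hcard := Finset.card_le_card_of_injOn J (fun z hz ↦ hmaps (hs hz)) (hinj.mono hs)
  have hyx : y - x = k * (θ₂ - θ₁) / (2 * Real.pi) + 1 / (2 * Real.pi) := by
    rw [hx, hy]; ring
  have h6 : 1 / (2 * Real.pi) ≤ 1 := by
    rw [div_le_one (by positivity)]; linarith
  have h7 : 0 ≤ k * (θ₂ - θ₁) / (2 * Real.pi) := by
    have := sub_nonneg.2 h12; positivity
  have h8 : 0 ≤ 1 / (2 * Real.pi) := by positivity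
  have h9 := card_Icc_ceil_floor_le (x := x) (y := y) (by linarith)
  have : (s.card : ℝ) ≤ (Finset.Icc ⌈x⌉ ⌊y⌋).card := by exact_mod_cast hcard
  linarith

lemma IsZeroIndex.index_unique {u : ℂ} {i j : ℤ} (hi : IsZeroIndex k a b Ψ u i)
    (hj : IsZeroIndex k a b Ψ u j) : i = j := by
  have h1 := hi.im_eq
  have h2 := hj.im_eq
  have : (i : ℝ) = j := by
    have := Real.pi_pos
    have : 2 * Real.pi * i = 2 * Real.pi * j := by linarith
    exact mul_left_cancel₀ (by positivity) this
  exact_mod_cast this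

lemma LargeWeight.exp_mem_fundDomain (h : LargeWeight k a b L) {u : ℂ}
    (hu : u ∈ innerLogBox k L) (hre : 0 ≤ u.re) (him : Real.pi / 2 ≤ u.im) :
    Complex.exp u ∈ fundDomain := by
  obtain ⟨h1, h2, h3⟩ := hu
  have hd := h.div_le
  have hs := h.scale_nonneg
  have hpi := Real.pi_pos
  have hpi' := Real.pi_lt_d2
  rw [abs_of_nonneg hre] at h1
  rcases hre.eq_or_lt with h0 | h0
  · right
    refine ⟨u.im, him, by linarith, ?_⟩
    congr 1
    apply Complex.ext <;> simp [← h0]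
  · left
    have hc := cos_two_pi_div_three_sub (t := 2 * Real.pi / 3 - u.im) (by linarith) (by linarith)
    rw [sub_sub_cancel] at hc
    have hc' : Real.cos u.im ≤ 0 := Real.cos_nonpos_of_pi_div_two_le_of_le him (by linarith)
    have he := (exp_bounds (s := u.re) (by rw [abs_of_pos h0]; linarith)).2
    rw [abs_of_pos h0] at he
    have he0 := Real.exp_pos u.re
    refine ⟨?_, ?_, ?_, ?_⟩
    · rw [Complex.exp_im]
      exact mul_pos he0 (Real.sin_pos_of_pos_of_lt_pi (by linarith) (by linarith))
    · rw [Complex.norm_exp]; exact Real.one_lt_exp_iff.2 h0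
    · rw [Complex.exp_re]
      have h5 : Real.exp u.re * (-(1 / 2) + (2 * Real.pi / 3 - u.im) / 2) ≤
        Real.exp u.re * Real.cos u.im := by gcongr
      have h6 : 1 ≤ Real.exp u.re := Real.one_le_exp h0.le
      nlinarith
    · rw [Complex.exp_re]; nlinarith

/-- Every index in the correspondingly shortened interval yields a zero; the condition on `Re u`
keeps it in the domain. -/
lemma LargeWeight.window_lower (h : LargeWeight k a b L) (h1 : Real.pi / 2 ≤ θ₁)
    (h2 : θ₂ ≤ 2 * Real.pi / 3 - 66 * (L / k))
    (hre : ∀ Ψ, IsPhase k a b L Ψ → ∀ u ∈ innerLogBox k L,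
      ∀ j, IsZeroIndex k a b Ψ u j → 0 ≤ u.re) :
    ∃ s : Finset ℂ, (∀ z ∈ s, z ∈ fundDomain ∧ eisenstein k a b z = 0 ∧ z.arg ∈ Set.Icc θ₁ θ₂) ∧
      k * (θ₂ - θ₁) / (2 * Real.pi) - 2 ≤ (s.card : ℝ) := by
  classical
  have hk := h.weight_pos
  have hpi := Real.pi_gt_three
  have hs := h.scale_nonneg
  obtain ⟨Ψ, hΨ⟩ := h.exists_phase
  set x := (k * θ₁ + 1 / 2 - (logRatio a b).im) / (2 * Real.pi) with hx
  set y := (k * θ₂ - 1 / 2 - (logRatio a b).im) / (2 * Real.pi) with hy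
  have hj {j : ℤ} (hj : j ∈ Finset.Icc ⌈x⌉ ⌊y⌋) :
      k * θ₁ + 1 / 2 ≤ (logRatio a b).im + 2 * Real.pi * j ∧
      (logRatio a b).im + 2 * Real.pi * j ≤ k * θ₂ - 1 / 2 := by
    rw [Finset.mem_Icc, Int.ceil_le, Int.le_floor, hx, hy, div_le_iff₀ (by positivity),
      le_div_iff₀ (by positivity)] at hj
    constructor <;> linarith [hj.1, hj.2]
  have hex : ∀ j ∈ Finset.Icc ⌈x⌉ ⌊y⌋, ∃ u ∈ innerLogBox k L, IsZeroIndex k a b Ψ u j := by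
    intro j hjm
    have := hj hjm
    have h3 : k * (Real.pi / 2) ≤ k * θ₁ := by gcongr
    have h4 : k * θ₂ ≤ k * (2 * Real.pi / 3 - 66 * (L / k)) := by gcongr
    exact hΨ.exists_zero h (by linarith) (by linarith)
  choose! U hU using hex
  have him {j : ℤ} (hjm : j ∈ Finset.Icc ⌈x⌉ ⌊y⌋) : θ₁ ≤ (U j).im ∧ (U j).im ≤ θ₂ := by
    have h3 := hj hjm
    have h4 := abs_le.1 ((hU j hjm).2.abs_im_sub_le hΨ h (hU j hjm).1)
    constructor
    · refine le_of_mul_le_mul_left ?_ hk; linarith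
    · refine le_of_mul_le_mul_left ?_ hk; linarith
  have hlog {j : ℤ} (hjm : j ∈ Finset.Icc ⌈x⌉ ⌊y⌋) : Complex.log (Complex.exp (U j)) = U j :=
    Complex.log_exp (by linarith [(him hjm).1]) (by linarith [(him hjm).2])
  refine ⟨(Finset.Icc ⌈x⌉ ⌊y⌋).image fun j ↦ Complex.exp (U j), ?_, ?_⟩
  · intro z hz
    obtain ⟨j, hjm, rfl⟩ := Finset.mem_image.1 hz
    obtain ⟨hu, huj⟩ := hU j hjm
    refine ⟨h.exp_mem_fundDomain hu (hre Ψ hΨ _ hu _ huj) (h1.trans (him hjm).1),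
      (hΨ.eq_zero_iff h (h.innerLogBox_subset hu)).2 ⟨j, huj⟩, ?_⟩
    rw [← Complex.log_im, hlog hjm]
    exact him hjm
  · rw [Finset.card_image_of_injOn]
    · refine le_trans ?_ (le_card_Icc_ceil_floor x y)
      have hyx : y - x = k * (θ₂ - θ₁) / (2 * Real.pi) - 1 / (2 * Real.pi) := by
        rw [hx, hy]; ring
      have h6 : 1 / (2 * Real.pi) ≤ 1 := by
        rw [div_le_one (by positivity)]; linarith
      linarith
    · intro i hi j hjm hij
      have e : U i = U j := by
        have := congrArg Complex.log hij
        rwa [hlog hi, hlog hjm] at this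
      exact (hU i hi).2.index_unique (e ▸ (hU j hjm).2)

/-- Either the two main coefficients have clearly different sizes, or they have the same size and
the zeros are symmetric with respect to the unit circle. -/
def RatioGap (k : ℕ) (a b L : ℝ) : Prop :=
  2 * Real.exp (-(2 * L)) ≤ |(logRatio a b).re| ∨
    ((logRatio a b).re = 0 ∧ ∀ z : ℂ, z ≠ 0 → eisenstein k a b z = 0 →
      eisenstein k a b ((starRingEnd ℂ) z)⁻¹ = 0)

lemma RatioGap.re_nonneg (hg : RatioGap k a b L) (h : LargeWeight k a b L)
    (h0 : 0 ≤ (logRatio a b).re) (hΨ : IsPhase k a b L Ψ) {u : ℂ} (hu : u ∈ innerLogBox k L)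
    {j : ℤ} (hj : IsZeroIndex k a b Ψ u j) : 0 ≤ u.re := by
  rcases hg with hg | ⟨-, hg⟩
  · rw [abs_of_nonneg h0] at hg
    exact (hj.re_pos hΨ h (h.innerLogBox_subset hu) hg).le
  · exact (hj.re_eq_zero hΨ h hu hg).ge

lemma RatioGap.re_neg (hg : RatioGap k a b L) (h : LargeWeight k a b L)
    (h0 : (logRatio a b).re < 0) (hΨ : IsPhase k a b L Ψ) {u : ℂ} (hu : u ∈ innerLogBox k L)
    {j : ℤ} (hj : IsZeroIndex k a b Ψ u j) : u.re < 0 := by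
  rcases hg with hg | ⟨hg, -⟩
  · rw [abs_of_neg h0] at hg
    exact hj.re_neg hΨ h (h.innerLogBox_subset hu) (by linarith)
  · exact absurd hg h0.ne

lemma weight_nonneg (z : ℂ) : 0 ≤ weight z := by
  unfold weight; split_ifs <;> norm_num

lemma weight_le_one (z : ℂ) : weight z ≤ 1 := by
  unfold weight; split_ifs <;> norm_num

/-- The weighted number of zeros of a single series in a part of the fundamental domain. -/
def seriesCount (k : ℕ) (a b : ℝ) (S : Set ℂ) : ℝ :=
  ∑ᶠ z ∈ fundDomain ∩ S, weight z * (analyticOrderNatAt (eisenstein k a b) z : ℝ)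

lemma LargeWeight.finite_zeros_leftHalf (h : LargeWeight k a b L) :
    {z ∈ leftHalf | eisenstein k a b z = 0}.Finite := by
  have hd := h.div_le
  have hpi := Real.pi_gt_three
  refine ((h.window_upper (θ₁ := Real.pi / 2) (θ₂ := 2 * Real.pi / 3 - 66 * (L / k))
    (by linarith) le_rfl).1.union h.corner_count.1).subset ?_
  rintro z ⟨hz, h0⟩
  rcases le_or_gt z.arg (2 * Real.pi / 3 - 66 * (L / k)) with h1 | h1
  · exact Or.inl ⟨hz, h0, (le_arg_of_mem_leftHalf hz).1, h1⟩
  · exact Or.inr ⟨hz, h0, h1⟩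

lemma LargeWeight.finite_zeros_fundDomain (h : LargeWeight k a b L) (h' : LargeWeight k a (-b) L) :
    {z ∈ fundDomain | eisenstein k a b z = 0}.Finite := by
  have hfin := h'.finite_zeros_leftHalf.image fun z ↦ -(starRingEnd ℂ) z
  refine (h.finite_zeros_leftHalf.union hfin).subset ?_
  rintro z ⟨hz, h0⟩
  obtain ⟨h1, h2, h3, h4⟩ := mem_fundDomain_bounds hz
  rcases le_or_gt z.re 0 with h5 | h5
  · exact Or.inl ⟨⟨h1, h2, h3, h5⟩, h0⟩
  · refine Or.inr ⟨-(starRingEnd ℂ) z, ⟨⟨?_, ?_, ?_, ?_⟩, ?_⟩, ?_⟩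
    · simpa using h1
    · simpa using h2
    · simp; linarith
    · simp; linarith
    · have hk0 : k ≠ 0 := by have := h.three_le; omega
      rw [← conj_eisenstein_neg_conj h.even hk0]
      simp [h0]
    · simp

/-- In a window, the weighted number of zeros of one series is proportional to the length of the
window, or zero, up to `O(L)`. -/
lemma LargeWeight.seriesCount_window (h : LargeWeight k a b L) (hg : RatioGap k a b L)
    (h1 : Real.pi / 2 ≤ θ₁) (h12 : θ₁ ≤ θ₂) (h2 : θ₂ ≤ 2 * Real.pi / 3) :
    |seriesCount k a b {z | z.arg ∈ Set.Icc θ₁ θ₂} -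
      (if 0 ≤ (logRatio a b).re then 1 else 0) * (k * (θ₂ - θ₁) / (2 * Real.pi))| ≤ 1000 * L := by
  classical
  have hk := h.weight_pos
  have hL := h.one_le
  have hpi := Real.pi_gt_three
  have hs := h.scale_nonneg
  obtain ⟨Ψ, hΨ⟩ := h.exists_phase
  set Θ := 2 * Real.pi / 3 - 66 * (L / k) with hΘ
  set S : Set ℂ := {z | z.arg ∈ Set.Icc θ₁ θ₂}
  set f : ℂ → ℝ := fun z ↦ weight z * (analyticOrderNatAt (eisenstein k a b) z : ℝ) with hf
  have hfin : {z ∈ fundDomain ∩ S | eisenstein k a b z = 0}.Finite :=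
    h.finite_zeros_leftHalf.subset fun z hz ↦
      ⟨mem_leftHalf_of_mem_fundDomain hz.1.1 (h1.trans hz.1.2.1), hz.2⟩
  set Z := hfin.toFinset with hZ
  have hmem {z : ℂ} : z ∈ Z ↔ (z ∈ fundDomain ∧ z ∈ S) ∧ eisenstein k a b z = 0 := by
    rw [hZ, Set.Finite.mem_toFinset]; rfl
  have hleft {z : ℂ} (hz : z ∈ Z) : z ∈ leftHalf :=
    mem_leftHalf_of_mem_fundDomain (hmem.1 hz).1.1 (h1.trans (hmem.1 hz).1.2.1)
  have hsum : seriesCount k a b S = ∑ z ∈ Z, f z := by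
    refine finsum_mem_eq_sum_of_inter_support_eq _ ?_
    ext z
    simp only [Set.mem_inter_iff, Finset.mem_coe, hmem, Function.mem_support]
    constructor
    · rintro ⟨hz, h0⟩
      refine ⟨⟨hz, apply_eq_zero_of_analyticOrderNatAt_ne_zero fun h3 ↦ h0 ?_⟩, h0⟩
      simp [h3]
    · rintro ⟨hz, h0⟩
      exact ⟨hz.1, h0⟩
  have hbox {z : ℂ} (hz : z ∈ Z) (hΘz : z.arg ≤ Θ) : Complex.log z ∈ innerLogBox k L :=
    h.log_mem_innerLogBox (hleft hz) (hmem.1 hz).2 hΘz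
  have hexp {z : ℂ} (hz : z ∈ Z) : Complex.exp (Complex.log z) = z :=
    Complex.exp_log (ne_zero_of_mem_leftHalf (hleft hz))
  have hord {z : ℂ} (hz : z ∈ Z) (hΘz : z.arg ≤ Θ) : f z = weight z := by
    have := hΨ.order_eq_one h (hbox hz hΘz) (by rw [hexp hz]; exact (hmem.1 hz).2)
    rw [hexp hz] at this
    simp [hf, this]
  rw [hsum, ← Finset.sum_filter_add_sum_filter_not Z (fun z ↦ z.arg ≤ Θ)]
  set B := Z.filter fun z ↦ z.arg ≤ Θ with hB
  set Q := Z.filter fun z ↦ ¬ z.arg ≤ Θ with hQ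
  have hQ0 : 0 ≤ ∑ z ∈ Q, f z :=
    Finset.sum_nonneg fun z _ ↦ mul_nonneg (weight_nonneg z) (Nat.cast_nonneg _)
  have hQ1 : ∑ z ∈ Q, f z ≤ 900 * L := by
    refine le_trans (Finset.sum_le_sum fun z _ ↦ ?_) (h.corner_count.2 Q fun z hz ↦ ?_)
    · exact mul_le_of_le_one_left (Nat.cast_nonneg _) (weight_le_one z)
    · obtain ⟨hz1, hz2⟩ := Finset.mem_filter.1 (Finset.mem_coe.1 hz)
      exact ⟨hleft hz1, (hmem.1 hz1).2, not_le.1 hz2⟩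
  have hBw : ∑ z ∈ B, f z = ∑ z ∈ B, weight z :=
    Finset.sum_congr rfl fun z hz ↦ hord (Finset.mem_filter.1 hz).1 (Finset.mem_filter.1 hz).2
  rw [hBw]
  have hBup : ∑ z ∈ B, weight z ≤ B.card := by
    refine (Finset.sum_le_sum fun z _ ↦ weight_le_one z).trans (by simp)
  have hΔ : 0 ≤ k * (θ₂ - θ₁) / (2 * Real.pi) := by
    have := sub_nonneg.2 h12; positivity
  split_ifs with hε
  -- Only `i` and `ρ` have weight below 1, and each loses less than 1.
  · have hBlow : (B.card : ℝ) - 2 ≤ ∑ z ∈ B, weight z := by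
      have hw (z : ℂ) : 1 - (if z = Complex.I then 1 else 0) - (if z = rho then 1 else 0) ≤
          weight z := by
        unfold weight; split_ifs <;> norm_num
      have := Finset.sum_le_sum fun z (_ : z ∈ B) ↦ hw z
      simp only [Finset.sum_sub_distrib, Finset.sum_ite_eq', Finset.sum_const, nsmul_eq_mul,
        mul_one] at this
      have e1 : (if Complex.I ∈ B then (1 : ℝ) else 0) ≤ 1 := by split_ifs <;> norm_num
      have e2 : (if rho ∈ B then (1 : ℝ) else 0) ≤ 1 := by split_ifs <;> norm_num
      linarith
    rw [one_mul, abs_le]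
    -- Truncating the window at `Θ` costs at most `66L`. A window beyond `Θ` lies in the corner, and
    -- its main term is itself at most `66L`.
    rcases le_or_gt θ₁ Θ with hc | hc
    · have hmin : θ₁ ≤ min θ₂ Θ := le_min h12 hc
      have hcard := (h.window_upper hmin (min_le_right _ _)).2 B fun z hz ↦ by
        obtain ⟨hz1, hz2⟩ := Finset.mem_filter.1 (Finset.mem_coe.1 hz)
        exact ⟨hleft hz1, (hmem.1 hz1).2, (hmem.1 hz1).1.2.1, le_min (hmem.1 hz1).1.2.2 hz2⟩
      obtain ⟨s, hs1, hs2⟩ := h.window_lower h1 (min_le_right θ₂ Θ)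
        (fun Ψ hΨ u hu j hj ↦ hg.re_nonneg h hε hΨ hu hj)
      have hsB : s.card ≤ B.card := by
        refine Finset.card_le_card fun z hz ↦ ?_
        obtain ⟨g1, g2, g3⟩ := hs1 z hz
        exact Finset.mem_filter.2 ⟨hmem.2 ⟨⟨g1, g3.1, g3.2.trans (min_le_left _ _)⟩, g2⟩,
          g3.2.trans (min_le_right _ _)⟩
      have hsB' : (s.card : ℝ) ≤ B.card := by exact_mod_cast hsB
      have e1 : k * (min θ₂ Θ - θ₁) / (2 * Real.pi) ≤ k * (θ₂ - θ₁) / (2 * Real.pi) := by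
        gcongr; exact min_le_left _ _
      have e2 : k * (θ₂ - θ₁) / (2 * Real.pi) - 66 * L ≤
          k * (min θ₂ Θ - θ₁) / (2 * Real.pi) := by
        have : θ₂ - 66 * (L / k) ≤ min θ₂ Θ := le_min (by linarith) (by linarith)
        have e3 : k * (θ₂ - 66 * (L / k) - θ₁) / (2 * Real.pi) ≤
          k * (min θ₂ Θ - θ₁) / (2 * Real.pi) := by gcongr
        refine le_trans ?_ e3
        have e4 : k * (θ₂ - 66 * (L / k) - θ₁) = k * (θ₂ - θ₁) - 66 * L := by field_simp; ring
        rw [e4, sub_div]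
        have : 66 * L / (2 * Real.pi) ≤ 66 * L := div_le_self (by linarith) (by linarith)
        linarith
      constructor <;> linarith
    · have hB0 : B = ∅ := by
        refine Finset.eq_empty_of_forall_notMem fun z hz ↦ ?_
        obtain ⟨hz1, hz2⟩ := Finset.mem_filter.1 hz
        linarith [(hmem.1 hz1).1.2.1]
      rw [hB0, Finset.sum_empty]
      have e2 : k * (θ₂ - θ₁) / (2 * Real.pi) ≤ 66 * L := by
        have : k * (θ₂ - θ₁) ≤ k * (66 * (L / k)) := by gcongr; linarith
        rw [show k * (66 * (L / k)) = 66 * L by field_simp] at this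
        refine (div_le_div_of_nonneg_right this (by positivity)).trans ?_
        exact div_le_self (by linarith) (by linarith)
      constructor <;> linarith
  -- For these series the solutions of the logarithmic equation lie strictly inside the unit circle.
  · have hB0 : B = ∅ := by
      refine Finset.eq_empty_of_forall_notMem fun z hz ↦ ?_
      obtain ⟨hz1, hz2⟩ := Finset.mem_filter.1 hz
      obtain ⟨j, hj⟩ := (hΨ.eq_zero_iff h (h.innerLogBox_subset (hbox hz1 hz2))).1
        (by rw [hexp hz1]; exact (hmem.1 hz1).2)
      have := hg.re_neg h (not_le.1 hε) hΨ (hbox hz1 hz2) hj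
      linarith [(h.re_log_lt (hleft hz1) (hmem.1 hz1).2).1]
    rw [hB0, Finset.sum_empty, zero_mul, abs_le]
    constructor <;> linarith

end

/-! ### Arithmetic of odd levels -/

lemma two_div_le_abs_sin {q : ℕ} (hq : 0 < q) {p : ℤ} (hp : ¬ (q : ℤ) ∣ p) :
    2 / q ≤ |Real.sin (Real.pi * p / q)| := by
  have hq' : (0 : ℝ) < q := by exact_mod_cast hq
  have hqz : (0 : ℤ) < q := by exact_mod_cast hq
  have hpi := Real.pi_pos
  set r := p % q with hr
  have hr0 : 0 ≤ r := Int.emod_nonneg _ hqz.ne'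
  have hr1 : r < q := Int.emod_lt_of_pos _ hqz
  have hr2 : r ≠ 0 := fun h ↦ hp (Int.dvd_of_emod_eq_zero h)
  have hpr : p = r + q * (p / q) := (Int.emod_add_mul_ediv p q).symm
  have e : Real.pi * p / q = Real.pi * r / q + (p / q : ℤ) * Real.pi := by
    have : (p : ℝ) = r + q * (p / q : ℤ) := by exact_mod_cast hpr
    rw [this]; field_simp
  rw [e, Real.sin_add_int_mul_pi, abs_mul, abs_zpow, abs_neg, abs_one, one_zpow, one_mul]
  have h1 : (1 : ℝ) ≤ r := by exact_mod_cast (by omega : 1 ≤ r)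
  have h2 : (r : ℝ) ≤ q - 1 := by
    have : r ≤ q - 1 := by omega
    exact_mod_cast this
  refine le_trans ?_ (le_abs_self _)
  have key {x : ℝ} (hx : 1 ≤ x) (hx' : x ≤ q / 2) : 2 / q ≤ Real.sin (Real.pi * x / q) := by
    have := Real.mul_le_sin (x := Real.pi * x / q) (by positivity) (by
      rw [div_le_iff₀ hq']; nlinarith)
    refine le_trans ?_ this
    rw [show 2 / Real.pi * (Real.pi * x / q) = 2 * x / q by field_simp]
    gcongr
    linarith
  rcases le_total (r : ℝ) (q / 2) with h3 | h3
  · exact key h1 h3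
  · have := key (x := q - r) (by linarith) (by linarith)
    rwa [show Real.pi * (q - r) / q = Real.pi - Real.pi * r / q by field_simp, Real.sin_pi_sub]
      at this

/-- `cos 2πA/N = sin(π(N - 4A)/(2N))`, and `N - 4A` is odd, so it is not a multiple of `2N`. -/
lemma inv_le_abs_cosTurn {N : ℕ} (hN : Odd N) (A : ℕ) : 1 / (N : ℝ) ≤ |cosTurn (A / N)| := by
  have hN0 : 0 < N := hN.pos
  have hN' : (0 : ℝ) < N := by exact_mod_cast hN0
  have hdvd : ¬ ((2 * N : ℕ) : ℤ) ∣ (N - 4 * A : ℤ) := by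
    obtain ⟨m, rfl⟩ := hN
    rintro ⟨c, hc⟩
    have : (2 : ℤ) * ((2 * m + 1) * c) = 2 * (m - 2 * A) + 1 := by
      push_cast at hc; linarith
    omega
  have := two_div_le_abs_sin (q := 2 * N) (by omega) hdvd
  have e : Real.pi * ((N - 4 * A : ℤ) : ℝ) / ((2 * N : ℕ) : ℝ) =
      Real.pi / 2 - 2 * Real.pi * (A / N) := by
    push_cast; field_simp; ring
  rw [e, Real.sin_pi_div_two_sub] at this
  refine le_trans (le_of_eq ?_) this
  push_cast
  field_simp

lemma cosTurn_sq_sub_sq {N : ℕ} (hN : 0 < N) (A B : ℕ) :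
    cosTurn (A / N) ^ 2 - cosTurn (B / N) ^ 2 =
      Real.sin (Real.pi * (2 * (A + B) : ℤ) / N) * Real.sin (Real.pi * (2 * (B - A) : ℤ) / N) := by
  have hN' : (N : ℝ) ≠ 0 := by exact_mod_cast hN.ne'
  have e1 : Real.pi * ((2 * (A + B) : ℤ) : ℝ) / N =
      2 * Real.pi * (B / N) + 2 * Real.pi * (A / N) := by push_cast; field_simp; ring
  have e2 : Real.pi * ((2 * (B - A) : ℤ) : ℝ) / N =
      2 * Real.pi * (B / N) - 2 * Real.pi * (A / N) := by push_cast; field_simp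
  rw [e1, e2, Real.sin_add, Real.sin_sub, cosTurn, cosTurn]
  have h1 := Real.sin_sq_add_cos_sq (2 * Real.pi * (A / N))
  have h2 := Real.sin_sq_add_cos_sq (2 * Real.pi * (B / N))
  linear_combination Real.cos (2 * Real.pi * (B / N)) ^ 2 * h1 -
    Real.cos (2 * Real.pi * (A / N)) ^ 2 * h2

/-- `2 log(y/x) ≥ 1 - x²/y² ≥ y² - x²`. -/
lemma two_div_sq_le_log_div {x y ε : ℝ} (hx : 0 < x) (hxy : x < y) (hy : y ≤ 1)
    (hε : 4 * ε ≤ y ^ 2 - x ^ 2) : 2 * ε ≤ Real.log (y / x) := by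
  have hy0 : 0 < y := hx.trans hxy
  have h1 := Real.one_sub_inv_le_log_of_pos (x := (y / x) ^ 2) (by positivity)
  rw [Real.log_pow] at h1
  have h2 : 1 - ((y / x) ^ 2)⁻¹ = (y ^ 2 - x ^ 2) / y ^ 2 := by
    field_simp
  have h3 : y ^ 2 - x ^ 2 ≤ (y ^ 2 - x ^ 2) / y ^ 2 :=
    le_div_self (by nlinarith) (by positivity) (by nlinarith)
  push_cast at h1
  linarith

/-- The difference of the squared cosines is a product of two sines. If one vanishes, 2 can be
cancelled modulo the odd `N`, so `b ≡ ±a` and reflection in the circle is a symmetry. Otherwise each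
sine is at least `2/N` in absolute value, and the difference `4/N²` becomes a logarithmic gap `2/N²
≥ 2e^{-2L}`. -/
lemma ratioGap_of_odd {N k A B : ℕ} {L : ℝ} (hN : Odd N) (hL : Real.exp (-L) ≤ 1 / N)
    (hk : Even k) (hk0 : k ≠ 0) (hA : A < N) (hB : B < N) :
    RatioGap k (A / N) (B / N) L := by
  have hN0 : 0 < N := hN.pos
  have hN' : (0 : ℝ) < N := by exact_mod_cast hN0
  have hcop : IsCoprime (N : ℤ) 2 := by
    rw [Int.isCoprime_iff_gcd_eq_one]
    exact_mod_cast hN.coprime_two_right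
  have ha := inv_le_abs_cosTurn hN A
  have hb := inv_le_abs_cosTurn hN B
  have hpos : 0 < 1 / (N : ℝ) := by positivity
  have hsq := cosTurn_sq_sub_sq hN0 A B
  by_cases h1 : (N : ℤ) ∣ 2 * (A + B) ∨ (N : ℤ) ∣ 2 * (B - A)
  · right
    have hsin {p : ℤ} (hp : (N : ℤ) ∣ p) : Real.sin (Real.pi * p / N) = 0 := by
      obtain ⟨c, rfl⟩ := hp
      rw [show Real.pi * ((N * c : ℤ) : ℝ) / N = c * Real.pi by push_cast; field_simp]
      exact Real.sin_int_mul_pi c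
    have hz : cosTurn (A / N) ^ 2 - cosTurn (B / N) ^ 2 = 0 := by
      rw [hsq]
      rcases h1 with h1 | h1
      · rw [hsin h1, zero_mul]
      · rw [hsin h1, mul_zero]
    have habs : |cosTurn (A / N)| = |cosTurn (B / N)| := by
      rw [← sq_eq_sq_iff_abs_eq_abs]; linarith
    have hswap (z : ℂ) : eisenstein k (B / N) (A / N) z = eisenstein k (A / N) (B / N) z := by
      rcases h1 with h1 | h1
      · obtain ⟨m, hm⟩ := hcop.dvd_of_dvd_mul_left h1
        refine eisenstein_swap_of_add_eq_int hk hk0 (m := m) ?_ z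
        have : (A : ℝ) + B = N * m := by exact_mod_cast hm
        rw [← add_div, this]
        field_simp
      · obtain ⟨m, hm⟩ := hcop.dvd_of_dvd_mul_left h1
        have hm0 : m = 0 := by
          have g1 : -1 < m := by
            by_contra! hc
            nlinarith [show (A : ℤ) < N by exact_mod_cast hA, show (0 : ℤ) ≤ B by positivity]
          have g2 : m < 1 := by
            by_contra! hc
            nlinarith [show (B : ℤ) < N by exact_mod_cast hB, show (0 : ℤ) ≤ A by positivity]
          omega
        have : B = A := by
          rw [hm0] at hm; omega
        rw [this]
    refine ⟨?_, fun z hz0 h0 ↦ ?_⟩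
    · rw [logRatio_re, habs, div_self (by linarith), Real.log_one]
    · have := conj_eisenstein_inv_conj hk0 (A / N) (B / N) hz0
      rw [hswap, h0, mul_zero, map_eq_zero] at this
      exact this
  · left
    rw [not_or] at h1
    have s1 := two_div_le_abs_sin hN0 h1.1
    have s2 := two_div_le_abs_sin hN0 h1.2
    have hprod : 4 * (1 / (N : ℝ)) ^ 2 ≤ |cosTurn (A / N) ^ 2 - cosTurn (B / N) ^ 2| := by
      rw [hsq, abs_mul]
      calc 4 * (1 / (N : ℝ)) ^ 2 = 2 / N * (2 / N) := by ring
        _ ≤ _ := by gcongr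
    have he : Real.exp (-(2 * L)) ≤ (1 / (N : ℝ)) ^ 2 := by
      rw [show -(2 * L) = ((2 : ℕ) : ℝ) * -L by push_cast; ring, Real.exp_nat_mul]
      gcongr
    refine (mul_le_mul_of_nonneg_left he zero_le_two).trans ?_
    rw [logRatio_re]
    rw [← sq_abs (cosTurn (A / N)), ← sq_abs (cosTurn (B / N))] at hprod
    have hpos2 : 0 < (1 / (N : ℝ)) ^ 2 := by positivity
    rcases lt_trichotomy |cosTurn (A / N)| |cosTurn (B / N)| with h2 | h2 | h2
    · rw [abs_of_neg (by nlinarith [abs_nonneg (cosTurn (A / N))])] at hprod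
      exact (two_div_sq_le_log_div (by linarith) h2 (abs_cosTurn_le _) (by linarith)).trans
        (le_abs_self _)
    · rw [h2, sub_self, abs_zero] at hprod
      linarith
    · rw [abs_of_pos (by nlinarith [abs_nonneg (cosTurn (B / N))])] at hprod
      have := two_div_sq_le_log_div (by linarith) h2 (abs_cosTurn_le _) hprod
      rw [← inv_div |cosTurn (B / N)|, Real.log_inv] at this
      exact this.trans (neg_le_abs _)

lemma cosTurn_neg (x : ℝ) : cosTurn (-x) = cosTurn x := by
  rw [cosTurn, cosTurn, mul_neg, Real.cos_neg]

/-- The size parameter of level `N`. -/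
def levelScale (N : ℕ) : ℝ := max 1 (Real.log N)

lemma exp_neg_levelScale_le {N : ℕ} (hN : 0 < N) : Real.exp (-levelScale N) ≤ 1 / N := by
  have hN' : (0 : ℝ) < N := by exact_mod_cast hN
  rw [Real.exp_neg, ← one_div]
  gcongr
  calc (N : ℝ) = Real.exp (Real.log N) := (Real.exp_log hN').symm
    _ ≤ _ := Real.exp_le_exp.2 (le_max_right _ _)

lemma exists_largeWeight (N : ℕ) (hN : Odd N) : ∃ K : ℕ, ∀ k : ℕ, K ≤ k → Even k →
    1000000 * levelScale N ≤ k ∧ ∀ A B : Fin N,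
      LargeWeight k ((A : ℝ) / N) ((B : ℝ) / N) (levelScale N) ∧
      LargeWeight k ((A : ℝ) / N) (-((B : ℝ) / N)) (levelScale N) ∧
      RatioGap k ((A : ℝ) / N) ((B : ℝ) / N) (levelScale N) := by
  obtain ⟨K₀, hK₀⟩ := exists_eisenstein_remainder_bound
  have hL : 1 ≤ levelScale N := le_max_left _ _
  have ht : Tendsto (fun k : ℕ ↦ K₀ * (5 / 6 : ℝ) ^ k) atTop (𝓝 (K₀ * 0)) :=
    (tendsto_pow_atTop_nhds_zero_of_lt_one (by norm_num) (by norm_num)).const_mul _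
  rw [mul_zero] at ht
  have h1 := ht.eventually_le_const (Real.exp_pos (-(6 * levelScale N)))
  have h2 : ∀ᶠ k : ℕ in atTop, 1000000 * levelScale N ≤ k :=
    tendsto_natCast_atTop_atTop.eventually_ge_atTop _
  obtain ⟨K, hK⟩ := eventually_atTop.1 (h1.and h2)
  refine ⟨K, fun k hk hke ↦ ?_⟩
  obtain ⟨g1, g2⟩ := hK k hk
  have hk3 : 3 ≤ k := by
    have : (3 : ℝ) ≤ k := by linarith
    exact_mod_cast this
  have hexp := exp_neg_levelScale_le hN.pos
  have hc (A : Fin N) := hexp.trans (inv_le_abs_cosTurn hN A)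
  have hmk (x y : ℝ) (hx : Real.exp (-levelScale N) ≤ |cosTurn x|)
      (hy : Real.exp (-levelScale N) ≤ |cosTurn y|) : LargeWeight k x y (levelScale N) :=
    ⟨hke, hL, by linarith, hx, hy, fun z hz ↦ (hK₀ k hk3 hke x y z hz).trans g1⟩
  exact ⟨g2, fun A B ↦ ⟨hmk _ _ (hc A) (hc B), hmk _ _ (hc A) (by rw [cosTurn_neg]; exact hc B),
    ratioGap_of_odd hN hexp hke (by omega) A.2 B.2⟩⟩

/-! ### Summation over the level and the discrepancy -/

lemma zeroCount_eq_sum {N k : ℕ} (hfin : (zeros N k).Finite) (S : Set ℂ) :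
    zeroCount N k S =
      ∑ A : Fin N, ∑ B : Fin N, seriesCount k ((A : ℝ) / N) ((B : ℝ) / N) S := by
  have hfin' : (zeros N k ∩ S).Finite := hfin.inter_of_left S
  have h1 (A B : Fin N) : seriesCount k ((A : ℝ) / N) ((B : ℝ) / N) S =
      ∑ z ∈ hfin'.toFinset, weight z *
        (analyticOrderNatAt (eisenstein k ((A : ℝ) / N) ((B : ℝ) / N)) z : ℝ) := by
    refine finsum_mem_eq_sum_of_subset _ ?_ ?_
    · rintro z ⟨⟨hz, hzS⟩, h0⟩
      rw [Finset.mem_coe, Set.Finite.mem_toFinset]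
      refine ⟨⟨hz, A, B, apply_eq_zero_of_analyticOrderNatAt_ne_zero fun h3 ↦ h0 ?_⟩, hzS⟩
      rw [levelEisenstein] at h3
      simp [h3]
    · intro z hz
      rw [Finset.mem_coe, Set.Finite.mem_toFinset] at hz
      exact ⟨hz.1.1, hz.2⟩
  rw [zeroCount, finsum_mem_eq_finite_toFinset_sum _ hfin']
  simp only [h1]
  rw [Finset.sum_congr rfl fun A _ ↦ Finset.sum_comm, Finset.sum_comm]
  refine Finset.sum_congr rfl fun z _ ↦ ?_
  rw [multiplicity]
  push_cast
  rw [Finset.mul_sum]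
  refine Finset.sum_congr rfl fun A _ ↦ ?_
  rw [Finset.mul_sum]
  rfl

/-- The ray `arg z = π/2` is itself a window, of length zero, so removing it costs only an error
term. -/
lemma zeroCount_left {N k : ℕ} (hfin : (zeros N k).Finite) :
    zeroCount N k {z | z.re < 0} =
      zeroCount N k {z | z.arg ∈ Set.Icc (Real.pi / 2) (2 * Real.pi / 3)} -
        zeroCount N k {z | z.arg ∈ Set.Icc (Real.pi / 2) (Real.pi / 2)} := by
  have hset : zeros N k ∩ {z | z.arg ∈ Set.Icc (Real.pi / 2) (2 * Real.pi / 3)} =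
      zeros N k ∩ {z | z.re < 0} ∪
        zeros N k ∩ {z | z.arg ∈ Set.Icc (Real.pi / 2) (Real.pi / 2)} := by
    have hpi := Real.pi_pos
    rw [← Set.inter_union_distrib_left]
    ext z
    refine and_congr_right fun hz ↦ ?_
    simp only [Set.mem_union, Set.mem_ofPred_eq, Set.Icc_self, Set.mem_singleton_iff, Set.mem_Icc]
    obtain ⟨h1, h2, h3, -⟩ := mem_fundDomain_bounds hz.1
    constructor
    · intro h4
      rcases (mem_leftHalf_of_mem_fundDomain hz.1 h4.1).2.2.2.lt_or_eq with h5 | h5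
      · exact Or.inl h5
      · exact Or.inr (Complex.arg_eq_pi_div_two_iff.2 ⟨h5, h1⟩)
    · rintro (h4 | h4)
      · exact le_arg_of_mem_leftHalf ⟨h1, h2, h3, h4.le⟩
      · rw [h4]; constructor <;> linarith
  rw [eq_sub_iff_add_eq, zeroCount, zeroCount, ← finsum_mem_union _ (hfin.inter_of_left _)
    (hfin.inter_of_left _), zeroCount, hset]
  rw [Set.disjoint_left]
  rintro z ⟨-, h1⟩ ⟨-, h2⟩
  rw [Set.mem_ofPred_eq, Set.Icc_self, Set.mem_singleton_iff, Complex.arg_eq_pi_div_two_iff] at h2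
  exact absurd h2.1 (ne_of_lt h1)

/-- The number of pairs `(A, B)` whose zeros accumulate on the arc. -/
def activePairs (N : ℕ) : ℝ :=
  ∑ A : Fin N, ∑ B : Fin N, if 0 ≤ (logRatio ((A : ℝ) / N) ((B : ℝ) / N)).re then 1 else 0

/-- Exchanging `A` and `B` negates the real part, so at least one of the two orders is counted. -/
lemma half_sq_le_activePairs (N : ℕ) : (N : ℝ) ^ 2 / 2 ≤ activePairs N := by
  have h1 : activePairs N + activePairs N = ∑ A : Fin N, ∑ B : Fin N,
      ((if 0 ≤ (logRatio ((A : ℝ) / N) ((B : ℝ) / N)).re then (1 : ℝ) else 0) +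
        (if 0 ≤ (logRatio ((B : ℝ) / N) ((A : ℝ) / N)).re then (1 : ℝ) else 0)) := by
    simp only [Finset.sum_add_distrib]
    rw [activePairs]
    congr 1
    exact Finset.sum_comm
  have h2 : ∑ A : Fin N, ∑ B : Fin N, (1 : ℝ) ≤ activePairs N + activePairs N := by
    rw [h1]
    gcongr with A _ B _
    have : (logRatio ((B : ℝ) / N) ((A : ℝ) / N)).re =
        -(logRatio ((A : ℝ) / N) ((B : ℝ) / N)).re := by
      rw [logRatio_re, logRatio_re, ← Real.log_inv, inv_div]
    rw [this]
    split_ifs <;> linarith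
  simp only [Finset.sum_const, Finset.card_univ, Fintype.card_fin, nsmul_eq_mul, mul_one] at h2
  nlinarith

/-- The counts of all series of level `N` in a window. -/
lemma abs_zeroCount_window_sub_le {N k : ℕ} (hfin : (zeros N k).Finite)
    (h : ∀ A B : Fin N,
      LargeWeight k ((A : ℝ) / N) ((B : ℝ) / N) (levelScale N) ∧
      RatioGap k ((A : ℝ) / N) ((B : ℝ) / N) (levelScale N)) {θ₁ θ₂ : ℝ}
    (h1 : Real.pi / 2 ≤ θ₁) (h12 : θ₁ ≤ θ₂) (h2 : θ₂ ≤ 2 * Real.pi / 3) :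
    |zeroCount N k {z | z.arg ∈ Set.Icc θ₁ θ₂} -
      activePairs N * (k * (θ₂ - θ₁) / (2 * Real.pi))| ≤ N ^ 2 * (1000 * levelScale N) := by
  rw [zeroCount_eq_sum hfin, activePairs, Finset.sum_mul, ← Finset.sum_sub_distrib]
  simp only [Finset.sum_mul, ← Finset.sum_sub_distrib]
  calc _ ≤ ∑ A : Fin N, ∑ B : Fin N, 1000 * levelScale N :=
        (Finset.abs_sum_le_sum_abs _ _).trans (Finset.sum_le_sum fun A _ ↦
          (Finset.abs_sum_le_sum_abs _ _).trans (Finset.sum_le_sum fun B _ ↦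
            (h A B).1.seriesCount_window (h A B).2 h1 h12 h2))
    _ = _ := by simp; ring

lemma angularDiscrepancy_nonneg (N k : ℕ) : 0 ≤ angularDiscrepancy N k := by
  refine Real.sSup_nonneg ?_
  rintro d ⟨θ₁, θ₂, -, -, -, rfl⟩
  exact abs_nonneg _

lemma angularDiscrepancy_bound (N : ℕ) (hN : Odd N) : ∃ K : ℕ, ∀ k : ℕ, K ≤ k → Even k →
    (zeros N k).Finite ∧ 0 < zeroCount N k {z | z.re < 0} ∧
      angularDiscrepancy N k ≤ 144000 * max 1 (Real.log N) / k := by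
  obtain ⟨K, hK⟩ := exists_largeWeight N hN
  refine ⟨K, fun k hk hke ↦ ?_⟩
  obtain ⟨hkL, hall⟩ := hK k hk hke
  have hfin : (zeros N k).Finite := by
    refine (Set.finite_iUnion fun A : Fin N ↦ Set.finite_iUnion fun B : Fin N ↦
      (hall A B).1.finite_zeros_fundDomain (hall A B).2.1).subset ?_
    rintro z ⟨hz, A, B, h0⟩
    exact Set.mem_iUnion.2 ⟨A, Set.mem_iUnion.2 ⟨B, hz, h0⟩⟩
  have hwin {θ₁ θ₂ : ℝ} := abs_zeroCount_window_sub_le (θ₁ := θ₁) (θ₂ := θ₂) hfin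
    fun A B ↦ ⟨(hall A B).1, (hall A B).2.2⟩
  have hpi := Real.pi_pos
  have hN1 : (1 : ℝ) ≤ N := by exact_mod_cast hN.pos
  have hL : 1 ≤ levelScale N := le_max_left _ _
  have hP := half_sq_le_activePairs N
  set P := activePairs N
  set L := levelScale N
  set Y := zeroCount N k {z | z.re < 0} with hY
  have hk0 : (0 : ℝ) < k := by linarith
  have hN2 : (0 : ℝ) < (N : ℝ) ^ 2 := by positivity
  have hYb : |Y - P * (k / 12)| ≤ N ^ 2 * (2000 * L) := by
    have e1 := abs_le.1 (hwin (le_refl (Real.pi / 2)) (by linarith) (le_refl (2 * Real.pi / 3)))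
    have e2 := abs_le.1 (hwin (le_refl (Real.pi / 2)) (le_refl (Real.pi / 2)) (by linarith))
    rw [show k * (2 * Real.pi / 3 - Real.pi / 2) / (2 * Real.pi) = k / 12 by
      field_simp; norm_num] at e1
    rw [sub_self, mul_zero, zero_div, mul_zero, sub_zero] at e2
    rw [hY, zeroCount_left hfin, abs_le]
    constructor <;> linarith
  -- The main term is at least `N²k/24`, and `k ≥ 10⁶L` lets half of it absorb the error `2000N²L`.
  have hYlow : N ^ 2 * (k / 48) ≤ Y := by
    have := (abs_le.1 hYb).1
    have h1 : N ^ 2 / 2 * ((k : ℝ) / 12) ≤ P * (k / 12) := by gcongr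
    have h2 : (N : ℝ) ^ 2 * (1000000 * L) ≤ N ^ 2 * k := by gcongr
    nlinarith
  have hY0 : 0 < Y := lt_of_lt_of_le (by positivity) hYlow
  refine ⟨hfin, hY0, Real.sSup_le ?_ (by positivity)⟩
  rintro d ⟨θ₁, θ₂, h1, h12, h2, rfl⟩
  have hX := hwin h1 h12 h2
  rw [← hY]
  set X := zeroCount N k {z | z.arg ∈ Set.Icc θ₁ θ₂}
  set c := 6 / Real.pi * (θ₂ - θ₁) with hc
  have hc0 : 0 ≤ c := mul_nonneg (by positivity) (by linarith)
  have hc1 : c ≤ 1 := by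
    rw [hc, div_mul_eq_mul_div, div_le_one hpi]
    linarith
  have e : k * (θ₂ - θ₁) / (2 * Real.pi) = c * (k / 12) := by
    rw [hc]; field_simp; ring
  rw [e] at hX
  -- Both main terms are proportional to `P` and cancel. The errors `1000 + 2000`, divided by the
  -- lower bound `N²k/48`, give `144000 = 3000 · 48`.
  have hXY : X / Y - c = ((X - P * (c * (k / 12))) - c * (Y - P * (k / 12))) / Y := by
    field_simp
    ring
  rw [hXY, abs_div, abs_of_pos hY0, div_le_div_iff₀ hY0 hk0]
  have hnum : |(X - P * (c * (k / 12))) - c * (Y - P * (k / 12))| ≤ N ^ 2 * (3000 * L) := by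
    refine (abs_sub _ _).trans ?_
    rw [abs_mul, abs_of_nonneg hc0]
    have : c * |Y - P * (k / 12)| ≤ 1 * (N ^ 2 * (2000 * L)) := by gcongr
    linarith
  calc _ ≤ N ^ 2 * (3000 * L) * k := by gcongr
    _ = 144000 * L * (N ^ 2 * (k / 48)) := by ring
    _ ≤ _ := mul_le_mul_of_nonneg_left hYlow (by positivity)

end EisensteinZeros

end

theorem mainTheorem5 :
    ∃ C : ℝ, 0 < C ∧ ∀ N : ℕ, Odd N →
      (∃ K : ℕ, ∀ k : ℕ, K ≤ k → Even k →
        (EisensteinZeros.zeros N k).Finite ∧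
        0 < EisensteinZeros.zeroCount N k {z | z.re < 0} ∧
        EisensteinZeros.angularDiscrepancy N k ≤ C * max 1 (Real.log N) / k) ∧
      Tendsto (fun k : ℕ => EisensteinZeros.angularDiscrepancy N k)
        (atTop ⊓ 𝓟 {k : ℕ | Even k}) (𝓝 0) := by
  refine ⟨144000, by norm_num, fun N hN ↦ ?_⟩
  have h := EisensteinZeros.angularDiscrepancy_bound N hN
  refine ⟨h, ?_⟩
  obtain ⟨K, hK⟩ := h
  have ht : Tendsto (fun k : ℕ ↦ 144000 * max 1 (Real.log N) / (k : ℝ))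
      (atTop ⊓ 𝓟 {k : ℕ | Even k}) (𝓝 0) :=
    (tendsto_const_div_atTop_nhds_zero_nat _).mono_left inf_le_left
  refine squeeze_zero' (Eventually.of_forall fun k ↦
    EisensteinZeros.angularDiscrepancy_nonneg N k) ?_ ht
  rw [eventually_inf_principal]
  filter_upwards [eventually_ge_atTop K] with k hk hke
  exact (hK k hk hke).2.2
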